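/- Let $k\ge 1$ and $n\ge 2k+1$. Label the vertices of the $n$-gon cyclically by $0,\dots,n-1$; its edges are the pairs $[u,v]$ with $0\le u<v\le n-1$, and $[u,v]$, $[u',v']$ cross if $u<u'<v<v'$ or $u'<u<v'<v$. A $k$-triangulation of the $n$-gon is an inclusion-maximal set $T$ of edges containing no $k+1$ mutually crossing edges. Place at each grid point $(u,v)$ with $[u,v]\in T$ ($u<v$) a double-faced mirror parallel to the diagonal $x=y$, which reflects a ray travelling to the right into a ray travelling up, and a ray travelling up into a ray travelling to the right. For $1\le i\le n-2k$, let the $i$th beam $B_i$ be the lattice path followed by the light ray coming horizontally (to the right) from $(-\infty,k-1+i)$. The beam vector $\psi(T)\in\mathbb R^{n-2k}$ has as $i$th coordinate the area of the region located below $B_i$ and inside the box $[0,k-1+i]\times[k-1+i,n-1]$. The beam polytope $\Omega_{n,k}$ is the convex hull of the beam vectors of all $k$-triangulations of the $n$-gon. A sequence $\sigma\in\{0,1\}^{n-2k}$ is $k$-valid if it is neither $(0,\dots,0)$ nor $(1,\dots,1)$ and contains no block of consecutive letters $1\,0^r\,1$ with $r\ge k$. Let $|\sigma|_0$ be the number of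 zeros of $\sigma$, and let $\zeta_i(\sigma)$ be the position of the $i$th zero of the word $0^k\sigma0^k$ of length $n$, whose positions are numbered $0,\dots,n-1$ (so that $\sigma_i$ stands at position $k-1+i$). Put $D(\sigma)=\{[\zeta_i(\sigma),\zeta_{i+k}(\sigma)] : 1\le i\le|\sigma|_0+k\}$ and $$F_\sigma=\{x\in\Omega_{n,k} : \langle\sigma,x\rangle\le\langle\sigma,y\rangle\text{ for all }y\in\Omega_{n,k}\}.$$ A facet of a polytope is a non-empty face whose dimension is one less than that of the polytope. Theorem. 1. For every $k$-valid $0/1$-sequence $\sigma$ of length $n-2k$, the set $F_\sigma$ is a facet of $\Omega_{n,k}$ (so $\sigma$ is an inner normal vector of this facet), and for every $k$-triangulation $T$ of the $n$-gon, $\psi(T)\in F_\sigma$ if and only if $D(\sigma)\subseteq T$. 2. Every facet of $\Omega_{n,k}$ is equal to $F_\sigma$ for some $k$-valid $0/1$-sequence $\sigma$ of length $n-2k$. -/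

import Mathlib

/-- Edges of the `n`-gon with vertices `0, …, n - 1`; the edge `[u, v]` is the pair `(u, v)`, `u < v`. -/
def polygonEdges (n : ℕ) : Finset (ℕ × ℕ) :=
  (Finset.range n ×ˢ Finset.range n).filter fun e => e.1 < e.2

/-- Two edges cross when their endpoints strictly alternate along the polygon. -/
def EdgesCross (e f : ℕ × ℕ) : Prop :=
  (e.1 < f.1 ∧ f.1 < e.2 ∧ e.2 < f.2) ∨ (f.1 < e.1 ∧ e.1 < f.2 ∧ f.2 < e.2)

/-- No `p` edges of `T` are mutually crossing. -/
def CrossingFree (p : ℕ) (T : Finset (ℕ × ℕ)) : Prop :=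
  ∀ C ⊆ T, (C : Set (ℕ × ℕ)).Pairwise EdgesCross → C.card ≠ p

/-- A `k`-triangulation of the `n`-gon: an inclusion-maximal `(k + 1)`-crossing-free set of edges. -/
def IsKTriangulation (n k : ℕ) (T : Finset (ℕ × ℕ)) : Prop :=
  Maximal (fun S : Finset (ℕ × ℕ) => S ⊆ polygonEdges n ∧ CrossingFree (k + 1) S) T

/-- A light ray arriving at the grid point `(x, y)`, travelling upwards if `up` is `true` and to
the right otherwise. -/
@[ext]
structure BeamState where
  x : ℕ
  y : ℕ
  up : Bool

/-- One step of the ray. There is a mirror at each grid point `(u, v)` with `[u, v]` an edge of `T`.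
It turns a ray travelling right into a ray travelling up and conversely; without a mirror the
direction is kept. Then the ray travels to the next grid point. -/
def beamStep (T : Finset (ℕ × ℕ)) (s : BeamState) : BeamState :=
  let up' := if (s.x, s.y) ∈ T then !s.up else s.up
  if up' then ⟨s.x, s.y + 1, up'⟩ else ⟨s.x + 1, s.y, up'⟩

/-- The beam coming horizontally from `(-∞, h)`. There is no mirror with negative abscissa, so the
beam arrives at `(0, h)` travelling right; `beam T h t` is its state `t` steps later. -/
def beam (T : Finset (ℕ × ℕ)) (h t : ℕ) : BeamState :=
  (beamStep T)^[t] ⟨0, h, false⟩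

/-- The unit square `[a, a + 1] × [b, b + 1]` lies below the beam coming from `(-∞, h)`: the beam
has a horizontal step from `(a, y)` to `(a + 1, y)` with `y ≥ b + 1`. -/
def SquareBelowBeam (T : Finset (ℕ × ℕ)) (h a b : ℕ) : Prop :=
  ∃ t, (beam T h t).x = a + 1 ∧ (beam T h t).up = false ∧ b + 1 ≤ (beam T h t).y

open Classical in
/-- The area of the region located below the beam coming from `(-∞, h)` and inside the box
`[0, h] × [h, n - 1]`. As the beam is a lattice path, this is a number of unit squares. -/
noncomputable def beamArea (n : ℕ) (T : Finset (ℕ × ℕ)) (h : ℕ) : ℕ :=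
  ((Finset.range h ×ˢ Finset.Ico h (n - 1)).filter fun s => SquareBelowBeam T h s.1 s.2).card

/-- The beam vector. With coordinates indexed from `0`, the beam of index `i` comes
from `(-∞, k + i)`. -/
noncomputable def beamVector (n k : ℕ) (T : Finset (ℕ × ℕ)) : Fin (n - 2 * k) → ℝ :=
  fun i => (beamArea n T (k + i) : ℝ)

/-- The beam polytope `Ω_{n,k}`. -/
def beamPolytope (n k : ℕ) : Set (Fin (n - 2 * k) → ℝ) :=
  convexHull ℝ {x | ∃ T, IsKTriangulation n k T ∧ x = beamVector n k T}

/-- `p`-valid 0/1-sequences of size `q` (`true` is `1`, `false` is `0`): not constant, and without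
a block `1 0 ⋯ 0 1` having at least `p` zeros. -/
def IsValidSeq (p : ℕ) {q : ℕ} (σ : Fin q → Bool) : Prop :=
  (∃ i, σ i = true) ∧ (∃ i, σ i = false) ∧
    ¬ ∃ i j : Fin q, (i : ℕ) + p < j ∧ σ i = true ∧ σ j = true ∧
      ∀ l : Fin q, i < l → l < j → σ l = false

/-- Position `p ∈ {0, …, n - 1}` of the word `0^k σ 0^k` of length `n` holds a zero
(the letter `σ i`, with `i` counted from `0`, stands at position `k + i`). -/
def IsZeroPos (n k : ℕ) (σ : Fin (n - 2 * k) → Bool) (p : ℕ) : Prop :=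
  p < n ∧ ∀ i : Fin (n - 2 * k), k + (i : ℕ) = p → σ i = false

/-- `zeroPos n k σ i` is the position of the zero of index `i` (counted from `0`) in `0^k σ 0^k`. -/
noncomputable def zeroPos (n k : ℕ) (σ : Fin (n - 2 * k) → Bool) (i : ℕ) : ℕ :=
  Nat.nth (IsZeroPos n k σ) i

/-- The number of zeros of `σ`. -/
def numZeros {q : ℕ} (σ : Fin q → Bool) : ℕ :=
  (Finset.univ.filter fun i => σ i = false).card

/-- The edge set `D(σ)`: it joins each of the first `|σ|₀ + k` zeros of `0^k σ 0^k` to the `k`-th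
zero after it. -/
noncomputable def edgeSetD (n k : ℕ) (σ : Fin (n - 2 * k) → Bool) : Finset (ℕ × ℕ) :=
  (Finset.range (numZeros σ + k)).image fun i => (zeroPos n k σ i, zeroPos n k σ (i + k))

/-- A 0/1-sequence as a vector. -/
def seqVector {q : ℕ} (σ : Fin q → Bool) : Fin q → ℝ :=
  fun i => if σ i then 1 else 0

/-- The face of `P` with inner normal vector `w`: the points of `P` at which `⟨w, ·⟩` is minimal
on `P`. -/
def faceOfNormal {q : ℕ} (P : Set (Fin q → ℝ)) (w : Fin q → ℝ) : Set (Fin q → ℝ) :=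
  {x | x ∈ P ∧ ∀ y ∈ P, w ⬝ᵥ x ≤ w ⬝ᵥ y}

/-- The affine dimension of a non-empty set. -/
noncomputable def affDim {q : ℕ} (P : Set (Fin q → ℝ)) : ℕ :=
  Module.finrank ℝ (affineSpan ℝ P).direction

/-- `F` is a facet of the polytope `P`: a non-empty face (the set of minimizers on `P` of a linear
form) whose dimension is one less than that of `P`. -/
def IsFacet {q : ℕ} (P F : Set (Fin q → ℝ)) : Prop :=
  F.Nonempty ∧ (∃ w : Fin q → ℝ, F = faceOfNormal P w) ∧ affDim F + 1 = affDim P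

/-!
The proof describes the beams by labels. Every ray that runs along the grid, whether it comes from
the left or from below, gets a label (`rayLabel`), which is the row it starts in if it comes from
the left. For a threshold `θ`, let `escapeCount T θ a b` be the number of rays with label at least
`θ` that leave the rectangle `[0, a) × [θ, b)` through its upper side. If there is a mirror at
`(a, b)`, then this number grows by exactly one when `a` and `b` are increased by one, so it is at
least the size of any crossing of `T` in the rectangle. If no two rays cross twice it is also
attained by a crossing. Hence in a `k`-triangulation no two rays cross twice, since a mirror could
be added at the first repeated crossing (`IsKTriangulation.rayLabel_below_le_left`), and at most
`k` rays escape. Together with the short edges, which belong to all `k`-triangulations, this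
implies that the beam from a middle row `h` leaves in the column `h`
(`IsKTriangulation.rayLabel_top`), and that the number of middle beams above a given unit square
does not depend on `T` (`IsKTriangulation.card_beamsAbove_eq`).

Let `S` be the set of the positions of the ones in `0^k σ 0^k`. If `T` contains `D(σ)`, then the
edges of `D(σ)` are the corners of a staircase that no beam crosses, except for straight initial
and final pieces of the beams from rows in `S` (`IsKTriangulation.separated`). So above each unit
square there are as few `S`-beams as possible, and `⟨σ, ψ(T)⟩` is minimal. Conversely, if the
number of `S`-beams is minimal above every square, then looking at the squares around a point of
`D(σ)` shows that there is a mirror at this point (`IsKTriangulation.stepEdges_subset_of_sum_le`).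
This works for every subset `S` of the middle vertices, not only for valid sequences.

If `𝒮` is a chain of such subsets, then the edge sets for all `S ∈ 𝒮` lie in a common
`k`-triangulation (`exists_isKTriangulation_of_isChain`). Now a linear form `w` is, up to a
constant, a positive combination of the indicators of its superlevel sets, which form a chain.
Therefore a minimizer of `w` minimizes all of these indicators (`sum_level_eq_zero`). Splitting a
superlevel set at its long gaps gives a valid sequence `σ` such that the face of `w` is contained
in `F_σ` (`exists_valid_face_subset`).

For the dimension of `F_σ`, let `w` be constant on `F_σ`. If `w` had two different values on the
ones of `σ`, or on its zeros, then the superlevel sets of `M σ + w` for large `M` would contain a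
set `J` strictly between `∅` and `σ`, or between `σ` and the set of all indices, and every
`k`-triangulation that contains `D(σ)` would contain the edges for `J`. This is refuted by a
`k`-triangulation that contains `D(σ)` and the edges for a set `S'` comparable with `σ`, some of
which cross an edge for `J` (`not_stepEdges_subset_of_close`). So the affine hull of `F_σ` is cut
out by the coordinate sum and the form `σ` (`vectorSpan_eq_zeroSums`).
-/

/-! ### Rays and their labels -/

section Labels

/-- The label of the ray that arrives at the grid point `(x, y)`, from below if `up` is `true` and
from the left otherwise. A ray coming from `(-∞, y)` has label `y`, and a ray coming from
`(x, -∞)` has the negative label `-1 - x`. -/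
def rayLabel (T : Finset (ℕ × ℕ)) : Bool → ℕ → ℕ → ℤ
  | false, 0, y => y
  | false, x + 1, y => if (x, y) ∈ T then rayLabel T true x y else rayLabel T false x y
  | true, x, 0 => -1 - (x : ℤ)
  | true, x, y + 1 => if (x, y) ∈ T then rayLabel T false x y else rayLabel T true x y
termination_by _ x y => x + y

variable (T : Finset (ℕ × ℕ))

theorem rayLabel_left_zero (y : ℕ) : rayLabel T false 0 y = y := by rw [rayLabel]

theorem rayLabel_left_succ (x y : ℕ) : rayLabel T false (x + 1) y =
    if (x, y) ∈ T then rayLabel T true x y else rayLabel T false x y := by rw [rayLabel]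

theorem rayLabel_below_zero (x : ℕ) : rayLabel T true x 0 = -1 - (x : ℤ) := by rw [rayLabel]

theorem rayLabel_below_succ (x y : ℕ) : rayLabel T true x (y + 1) =
    if (x, y) ∈ T then rayLabel T false x y else rayLabel T true x y := by rw [rayLabel]

theorem rayLabel_beamStep (s : BeamState) :
    rayLabel T (beamStep T s).up (beamStep T s).x (beamStep T s).y = rayLabel T s.up s.x s.y := by
  rcases s with ⟨x, y, up⟩
  by_cases h : (x, y) ∈ T <;> cases up <;>
    simp [beamStep, h, rayLabel_left_succ, rayLabel_below_succ]

theorem beam_zero (h : ℕ) : beam T h 0 = ⟨0, h, false⟩ := rfl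

theorem beam_succ (h t : ℕ) : beam T h (t + 1) = beamStep T (beam T h t) :=
  Function.iterate_succ_apply' _ _ _

theorem rayLabel_beam (h t : ℕ) :
    rayLabel T (beam T h t).up (beam T h t).x (beam T h t).y = h := by
  induction t with
  | zero => simp [beam_zero, rayLabel_left_zero]
  | succ t ih => rw [beam_succ, rayLabel_beamStep, ih]

theorem exists_beam_eq_of_rayLabel (h : ℕ) (up : Bool) (x y : ℕ)
    (hl : rayLabel T up x y = h) : ∃ t, beam T h t = ⟨x, y, up⟩ := by
  induction hs : x + y using Nat.strong_induction_on generalizing up x y with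
  | _ m ih =>
    subst hs
    match up, x, y, hl with
    | false, 0, y, hl =>
      rw [rayLabel_left_zero] at hl
      exact ⟨0, by rw [beam_zero]; congr; exact_mod_cast hl.symm⟩
    | false, x + 1, y, hl =>
      rw [rayLabel_left_succ] at hl
      by_cases hm : (x, y) ∈ T
      · rw [if_pos hm] at hl
        obtain ⟨t, ht⟩ := ih (x + y) (by omega) true x y hl rfl
        exact ⟨t + 1, by rw [beam_succ, ht]; simp [beamStep, hm]⟩
      · rw [if_neg hm] at hl
        obtain ⟨t, ht⟩ := ih (x + y) (by omega) false x y hl rfl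
        exact ⟨t + 1, by rw [beam_succ, ht]; simp [beamStep, hm]⟩
    | true, x, 0, hl =>
      rw [rayLabel_below_zero] at hl
      omega
    | true, x, y + 1, hl =>
      rw [rayLabel_below_succ] at hl
      by_cases hm : (x, y) ∈ T
      · rw [if_pos hm] at hl
        obtain ⟨t, ht⟩ := ih (x + y) (by omega) false x y hl rfl
        exact ⟨t + 1, by rw [beam_succ, ht]; simp [beamStep, hm]⟩
      · rw [if_neg hm] at hl
        obtain ⟨t, ht⟩ := ih (x + y) (by omega) true x y hl rfl
        exact ⟨t + 1, by rw [beam_succ, ht]; simp [beamStep, hm]⟩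

theorem rayLabel_eq_iff (h : ℕ) (up : Bool) (x y : ℕ) :
    rayLabel T up x y = h ↔ ∃ t, beam T h t = ⟨x, y, up⟩ := by
  refine ⟨exists_beam_eq_of_rayLabel T h up x y, ?_⟩
  rintro ⟨t, ht⟩
  simpa [ht] using rayLabel_beam T h t

/-- A beam moves one unit in the direction in which it then arrives. -/
theorem beam_succ_coords (h t : ℕ) :
    ((beam T h (t + 1)).up = true ∧ (beam T h (t + 1)).x = (beam T h t).x ∧
      (beam T h (t + 1)).y = (beam T h t).y + 1) ∨
    ((beam T h (t + 1)).up = false ∧ (beam T h (t + 1)).x = (beam T h t).x + 1 ∧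
      (beam T h (t + 1)).y = (beam T h t).y) := by
  rw [beam_succ]
  generalize beam T h t = s
  rcases s with ⟨x, y, up⟩
  by_cases hm : (x, y) ∈ T <;> cases up <;> simp [beamStep, hm]

theorem beam_coords_of_lt (h : ℕ) {t t' : ℕ} (htt : t < t') :
    ((beam T h t).x < (beam T h t').x ∨
      ((beam T h t').x = (beam T h t).x ∧ (beam T h t').up = true)) ∧
    ((beam T h t).y < (beam T h t').y ∨
      ((beam T h t').y = (beam T h t).y ∧ (beam T h t').up = false)) := by
  induction t' with
  | zero => omega
  | succ m ih =>
    rcases beam_succ_coords T h m with ⟨h1, h2, h3⟩ | ⟨h1, h2, h3⟩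
    all_goals
      rcases Nat.lt_succ_iff_lt_or_eq.mp htt with hlt | rfl
      · obtain ⟨h4, h5⟩ := ih hlt
        constructor
        · rcases h4 with h4 | h4 <;> simp [h1, h2] <;> omega
        · rcases h5 with h5 | h5 <;> simp [h1, h3] <;> omega
      · simp [h1, h2, h3]

theorem le_beam_y (h t : ℕ) : h ≤ (beam T h t).y := by
  rcases Nat.eq_zero_or_pos t with rfl | ht
  · simp [beam_zero]
  · have := (beam_coords_of_lt T h ht).2
    simp only [beam_zero] at this
    omega

variable {T}

theorem rayLabel_left_inj {x y y' h : ℕ} (h1 : rayLabel T false x y = h)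
    (h2 : rayLabel T false x y' = h) : y = y' := by
  obtain ⟨t, ht⟩ := (rayLabel_eq_iff T h _ _ _).1 h1
  obtain ⟨t', ht'⟩ := (rayLabel_eq_iff T h _ _ _).1 h2
  rcases lt_trichotomy t t' with hlt | rfl | hlt
  · have := (beam_coords_of_lt T h hlt).1
    simp [ht, ht'] at this
  · rw [ht] at ht'; simpa using ht'
  · have := (beam_coords_of_lt T h hlt).1
    simp [ht, ht'] at this

theorem rayLabel_below_inj {x x' y h : ℕ} (h1 : rayLabel T true x y = h)
    (h2 : rayLabel T true x' y = h) : x = x' := by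
  obtain ⟨t, ht⟩ := (rayLabel_eq_iff T h _ _ _).1 h1
  obtain ⟨t', ht'⟩ := (rayLabel_eq_iff T h _ _ _).1 h2
  rcases lt_trichotomy t t' with hlt | rfl | hlt
  · have := (beam_coords_of_lt T h hlt).2
    simp [ht, ht'] at this
  · rw [ht] at ht'; simpa using ht'
  · have := (beam_coords_of_lt T h hlt).2
    simp [ht, ht'] at this

theorem le_of_rayLabel_eq {up : Bool} {x y h : ℕ} (hl : rayLabel T up x y = h) : h ≤ y := by
  obtain ⟨t, ht⟩ := (rayLabel_eq_iff T h _ _ _).1 hl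
  simpa [ht] using le_beam_y T h t

theorem rayLabel_le (up : Bool) (x y : ℕ) : rayLabel T up x y ≤ y := by
  by_cases h : 0 ≤ rayLabel T up x y
  · obtain ⟨m, hm⟩ := Int.eq_ofNat_of_zero_le h
    have := le_of_rayLabel_eq hm
    omega
  · omega

/-- A ray that arrives from below has started strictly lower. -/
theorem rayLabel_below_lt (x y : ℕ) : rayLabel T true x y < y := by
  cases y with
  | zero => rw [rayLabel_below_zero]; push_cast; omega
  | succ y =>
    rw [rayLabel_below_succ]
    split_ifs
    · have := rayLabel_le (T := T) false x y; push_cast; omega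
    · have := rayLabel_le (T := T) true x y; push_cast; omega

/-- A beam that leaves the grid upwards in the column `h'` has crossed each vertical strip to the
left of it. -/
theorem exists_rayLabel_left_eq {h h' m a : ℕ} (hl : rayLabel T true h' m = h) (ha : a < h') :
    ∃ y, h ≤ y ∧ y < m ∧ rayLabel T false (a + 1) y = h := by
  obtain ⟨t, ht⟩ := (rayLabel_eq_iff T h _ _ _).1 hl
  have hex : ∃ t, a + 1 ≤ (beam T h t).x := ⟨t, by simp [ht]; omega⟩
  classical
  obtain ⟨r, hr⟩ : ∃ r, r = Nat.find hex := ⟨_, rfl⟩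
  have h1 := Nat.find_spec hex
  rw [← hr] at h1
  cases r with
  | zero => simp [beam_zero] at h1
  | succ r =>
    have h2 : ¬ a + 1 ≤ (beam T h r).x := Nat.find_min hex (by omega)
    rcases beam_succ_coords T h r with ⟨h3, h4, h5⟩ | ⟨h3, h4, h5⟩
    · omega
    · have hs : beam T h (r + 1) = ⟨a + 1, (beam T h (r + 1)).y, false⟩ := by
        ext
        · simp; omega
        · rfl
        · simp [h3]
      have hy : rayLabel T false (a + 1) (beam T h (r + 1)).y = h :=
        (rayLabel_eq_iff T h _ _ _).2 ⟨_, hs⟩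
      refine ⟨_, le_beam_y T h _, ?_, hy⟩
      rcases lt_trichotomy (r + 1) t with hlt | heq | hlt
      · have := (beam_coords_of_lt T h hlt).2
        simp [ht] at this
        exact this
      · rw [heq, ht] at h3; simp at h3
      · have := Nat.find_min' hex (m := t) (by simp [ht]; omega)
        omega

/-- A beam that arrives from below at `(h', m)` does not pass to the right of the column `h'` below
the row `m`. -/
theorem lt_of_rayLabel_left_eq {h h' m a y : ℕ} (hl : rayLabel T true h' m = h)
    (hy : rayLabel T false (a + 1) y = h) (hym : y < m) : a < h' := by
  obtain ⟨t, ht⟩ := (rayLabel_eq_iff T h _ _ _).1 hl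
  obtain ⟨t', ht'⟩ := (rayLabel_eq_iff T h _ _ _).1 hy
  rcases lt_trichotomy t t' with hlt | rfl | hlt
  · have := (beam_coords_of_lt T h hlt).2
    simp [ht, ht'] at this
    omega
  · rw [ht] at ht'; simp at ht'
  · have := (beam_coords_of_lt T h hlt).1
    simp [ht, ht'] at this
    omega

end Labels

/-! ### Crossing edges and short edges -/

section Crossings

theorem mem_polygonEdges {n : ℕ} {e : ℕ × ℕ} : e ∈ polygonEdges n ↔ e.1 < e.2 ∧ e.2 < n := by
  simp only [polygonEdges, Finset.mem_filter, Finset.mem_product, Finset.mem_range]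
  omega

theorem CrossingFree.card_lt {p : ℕ} {T C : Finset (ℕ × ℕ)} (hT : CrossingFree p T) (hC : C ⊆ T)
    (hp : (C : Set (ℕ × ℕ)).Pairwise EdgesCross) : C.card < p := by
  by_contra! hlt
  obtain ⟨D, hD, hcard⟩ := Finset.exists_subset_card_eq hlt
  exact hT D (hD.trans hC) (hp.mono (by exact_mod_cast hD)) hcard

/-- In a set of mutually crossing edges, every edge other than `e` has exactly one endpoint
strictly between the endpoints of `e`, and these endpoints are distinct. -/
theorem card_le_card_inter_Ioo_add_one {C : Finset (ℕ × ℕ)} {W : Finset ℕ} {e : ℕ × ℕ}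
    (hp : (C : Set (ℕ × ℕ)).Pairwise EdgesCross) (he : e ∈ C)
    (hW : ∀ f ∈ C, f.1 ∈ W ∧ f.2 ∈ W) : C.card ≤ (W ∩ Finset.Ioo e.1 e.2).card + 1 := by
  rw [← Finset.card_erase_add_one he, Nat.add_le_add_iff_right]
  refine Finset.card_le_card_of_injOn (fun f => if e.1 < f.1 ∧ f.1 < e.2 then f.1 else f.2) ?_ ?_
  · intro f hf
    obtain ⟨hne, hf⟩ := Finset.mem_erase.1 hf
    have hc := hp he hf hne.symm
    have := hW f hf
    unfold EdgesCross at hc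
    simp only [Finset.coe_inter, Set.mem_inter_iff, Finset.mem_coe, Finset.mem_Ioo]
    split_ifs <;> refine ⟨by tauto, ?_⟩ <;> omega
  · intro f hf g hg hfg
    obtain ⟨hne, hf⟩ := Finset.mem_erase.1 hf
    obtain ⟨hne', hg⟩ := Finset.mem_erase.1 hg
    by_contra hne2
    have h1 := hp he hf hne.symm
    have h2 := hp he hg hne'.symm
    have h3 := hp hf hg hne2
    unfold EdgesCross at h1 h2 h3
    dsimp only at hfg
    split_ifs at hfg <;> omega

/-- The same for the endpoints that are not between those of `e`. -/
theorem card_le_card_sdiff_Icc_add_one {C : Finset (ℕ × ℕ)} {W : Finset ℕ} {e : ℕ × ℕ}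
    (hp : (C : Set (ℕ × ℕ)).Pairwise EdgesCross) (he : e ∈ C)
    (hW : ∀ f ∈ C, f.1 ∈ W ∧ f.2 ∈ W) : C.card ≤ (W \ Finset.Icc e.1 e.2).card + 1 := by
  rw [← Finset.card_erase_add_one he, Nat.add_le_add_iff_right]
  refine Finset.card_le_card_of_injOn (fun f => if e.1 < f.1 ∧ f.1 < e.2 then f.2 else f.1) ?_ ?_
  · intro f hf
    obtain ⟨hne, hf⟩ := Finset.mem_erase.1 hf
    have hc := hp he hf hne.symm
    have := hW f hf
    unfold EdgesCross at hc
    simp only [Finset.coe_sdiff, Set.mem_sdiff, Finset.mem_coe, Finset.mem_Icc]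
    split_ifs <;> refine ⟨by tauto, ?_⟩ <;> omega
  · intro f hf g hg hfg
    obtain ⟨hne, hf⟩ := Finset.mem_erase.1 hf
    obtain ⟨hne', hg⟩ := Finset.mem_erase.1 hg
    by_contra hne2
    have h1 := hp he hf hne.symm
    have h2 := hp he hg hne'.symm
    have h3 := hp hf hg hne2
    unfold EdgesCross at h1 h2 h3
    dsimp only at hfg
    split_ifs at hfg <;> omega

variable {n k : ℕ} {T : Finset (ℕ × ℕ)}

theorem IsKTriangulation.subset (hT : IsKTriangulation n k T) : T ⊆ polygonEdges n := hT.prop.1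

theorem IsKTriangulation.crossingFree (hT : IsKTriangulation n k T) : CrossingFree (k + 1) T :=
  hT.prop.2

theorem IsKTriangulation.mem_of_crossingFree_insert (hT : IsKTriangulation n k T) {e : ℕ × ℕ}
    (he : e ∈ polygonEdges n) (hc : CrossingFree (k + 1) (insert e T)) : e ∈ T :=
  hT.le_of_ge ⟨Finset.insert_subset he hT.subset, hc⟩ (Finset.subset_insert e T)
    (Finset.mem_insert_self e T)

/-- An edge with at most `k - 1` vertices of the polygon on one of its sides crosses too few others
to be part of a `(k + 1)`-crossing, so it belongs to every `k`-triangulation. -/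
theorem IsKTriangulation.mem_of_short (hT : IsKTriangulation n k T) {u v : ℕ} (huv : u < v)
    (hv : v < n) (hs : v ≤ u + k ∨ u + n ≤ v + k) : (u, v) ∈ T := by
  refine hT.mem_of_crossingFree_insert (mem_polygonEdges.2 ⟨huv, hv⟩) fun C hC hp hcard => ?_
  by_cases he : (u, v) ∈ C
  · have hW : ∀ f ∈ C, f.1 ∈ Finset.range n ∧ f.2 ∈ Finset.range n := by
      intro f hf
      have : f ∈ polygonEdges n :=
        Finset.insert_subset (mem_polygonEdges.2 ⟨huv, hv⟩) hT.subset (hC hf)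
      rw [mem_polygonEdges] at this
      simp only [Finset.mem_range]
      omega
    have h1 := card_le_card_inter_Ioo_add_one hp he hW
    have h2 := card_le_card_sdiff_Icc_add_one hp he hW
    have h3 : (Finset.range n ∩ Finset.Ioo u v).card ≤ v - u - 1 := by
      rw [← Nat.card_Ioo]
      exact Finset.card_le_card Finset.inter_subset_right
    have h4 : (Finset.range n \ Finset.Icc u v).card = n - (v + 1 - u) := by
      rw [Finset.card_sdiff_of_subset, Finset.card_range, Nat.card_Icc]
      intro x hx
      simp only [Finset.mem_Icc, Finset.mem_range] at hx ⊢
      omega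
    simp only at h1 h2
    omega
  · have := hT.crossingFree.card_lt ((Finset.subset_insert_iff_of_notMem he).1 hC) hp
    omega

end Crossings

/-! ### Rays that escape from a rectangle -/

section EscapeCount

/-- The number of rays with label at least `θ` that leave the rectangle `[0, a) × [θ, b)` through
its upper side. -/
def escapeCount (T : Finset (ℕ × ℕ)) (θ a b : ℕ) : ℕ :=
  ((Finset.range a).filter fun x => (θ : ℤ) ≤ rayLabel T true x b).card

variable {T : Finset (ℕ × ℕ)} {θ : ℕ}

theorem escapeCount_zero_left (b : ℕ) : escapeCount T θ 0 b = 0 := by simp [escapeCount]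

theorem escapeCount_self_right (a : ℕ) : escapeCount T θ a θ = 0 := by
  rw [escapeCount, Finset.card_eq_zero, Finset.filter_eq_empty_iff]
  intro x _
  have := rayLabel_below_lt (T := T) x θ
  omega

theorem escapeCount_succ_left (a b : ℕ) : escapeCount T θ (a + 1) b =
    escapeCount T θ a b + if (θ : ℤ) ≤ rayLabel T true a b then 1 else 0 := by
  rw [escapeCount, Finset.range_add_one, Finset.filter_insert]
  split_ifs
  · rw [Finset.card_insert_of_notMem (by simp)]; rfl
  · rfl

theorem escapeCount_succ_right (a : ℕ) {b : ℕ} (hb : θ ≤ b) : escapeCount T θ a (b + 1) =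
    escapeCount T θ a b + if rayLabel T false a b < θ then 1 else 0 := by
  induction a with
  | zero => simp [escapeCount_zero_left, rayLabel_left_zero]; omega
  | succ a ih =>
    rw [escapeCount_succ_left, ih, escapeCount_succ_left, rayLabel_left_succ, rayLabel_below_succ]
    split_ifs <;> omega

/-- A mirror at `(a, b)` exchanges the two rays that meet there, so exactly one of the steps from
`(a, b)` to `(a + 1, b + 1)` increases the count, whatever the labels are. -/
theorem escapeCount_succ_succ_of_mem {a b : ℕ} (hb : θ ≤ b) (hm : (a, b) ∈ T) :
    escapeCount T θ (a + 1) (b + 1) = escapeCount T θ a b + 1 := by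
  rw [escapeCount_succ_left, escapeCount_succ_right a hb, rayLabel_below_succ, if_pos hm]
  split_ifs <;> omega

theorem escapeCount_mono {a a' b b' : ℕ} (ha : a ≤ a') (hb : θ ≤ b) (hbb : b ≤ b') :
    escapeCount T θ a b ≤ escapeCount T θ a' b' := by
  have h1 : escapeCount T θ a b ≤ escapeCount T θ a' b := by
    refine Finset.card_le_card (Finset.filter_subset_filter _ ?_)
    exact Finset.range_subset_range.2 ha
  refine h1.trans ?_
  induction b', hbb using Nat.le_induction with
  | base => rfl
  | succ m hm ih => exact ih.trans (by rw [escapeCount_succ_right a' (by omega)]; omega)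

/-- Mutually crossing mirrors in the rectangle `[0, a) × [θ, b)` give a lower bound for the number
of escaping rays. -/
theorem card_le_escapeCount {C : Finset (ℕ × ℕ)} (hC : C ⊆ T)
    (hp : (C : Set (ℕ × ℕ)).Pairwise EdgesCross) {a b : ℕ}
    (hb : θ ≤ b) (hrect : ∀ e ∈ C, e.1 < a ∧ θ ≤ e.2 ∧ e.2 < b) : C.card ≤ escapeCount T θ a b := by
  induction hm : C.card generalizing C a b with
  | zero => omega
  | succ m ih =>
    obtain ⟨e, he, hmax⟩ := C.exists_max_image Prod.fst (Finset.card_pos.1 (by omega))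
    obtain ⟨h1, h2, h3⟩ := hrect e he
    have key := ih (C := C.erase e) ((Finset.erase_subset _ _).trans hC)
      (hp.mono (by exact_mod_cast Finset.erase_subset _ _)) (a := e.1) (b := e.2) h2 ?_
      (by rw [Finset.card_erase_of_mem he]; omega)
    · have h4 := escapeCount_succ_succ_of_mem (a := e.1) (b := e.2) h2 (hC he)
      have h5 := escapeCount_mono (T := T) (θ := θ) (a := e.1 + 1) (a' := a) (b := e.2 + 1)
        (b' := b) h1 (by omega) h3
      omega
    · intro f hf
      obtain ⟨hne, hf⟩ := Finset.mem_erase.1 hf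
      have h4 := hp hf he hne
      have h5 := hmax f hf
      have h6 := hrect f hf
      unfold EdgesCross at h4
      omega

/-- If no two rays cross twice in the rectangle `[0, a) × [θ, b)`, then the number of escaping rays
is attained by mutually crossing mirrors. Rays cross for the second time where the one arriving from
below has the larger label. -/
theorem exists_crossing_card_eq_escapeCount {a b : ℕ} (ha : a ≤ θ) (hb : θ ≤ b)
    (hgood : ∀ x y, x < a → θ ≤ y → y < b → (x, y) ∉ T →
      rayLabel T true x y ≤ rayLabel T false x y) :
    ∃ C ⊆ T, (C : Set (ℕ × ℕ)).Pairwise EdgesCross ∧ C.card = escapeCount T θ a b ∧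
      ∀ e ∈ C, e.1 < a ∧ θ ≤ e.2 ∧ e.2 < b := by
  induction hs : a + b using Nat.strong_induction_on generalizing a b with
  | _ s ih =>
    subst hs
    rcases Nat.eq_zero_or_pos a with rfl | ha0
    · exact ⟨∅, by simp, by simp, by simp [escapeCount_zero_left], by simp⟩
    rcases hb.eq_or_lt with rfl | hb0
    · exact ⟨∅, by simp, by simp, by simp [escapeCount_self_right], by simp⟩
    obtain ⟨a, rfl⟩ := Nat.exists_eq_succ_of_ne_zero ha0.ne'
    obtain ⟨b, rfl⟩ := Nat.exists_eq_succ_of_ne_zero (Nat.ne_zero_of_lt hb0)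
    simp only [Nat.succ_eq_add_one] at *
    by_cases hm : (a, b) ∈ T
    · obtain ⟨C, hC, hp, hcard, hrect⟩ := ih (a + b) (by omega) (a := a) (b := b) (by omega)
        (by omega) (fun x y hx hy hy' => hgood x y (by omega) hy (by omega)) rfl
      have hnot : (a, b) ∉ C := fun h => by have := hrect _ h; omega
      refine ⟨insert (a, b) C, Finset.insert_subset hm hC, ?_, ?_, ?_⟩
      · rw [Finset.coe_insert]
        refine hp.insert fun f hf _ => ?_
        have := hrect f hf
        unfold EdgesCross
        simp only
        omega
      · rw [Finset.card_insert_of_notMem hnot, hcard,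
          escapeCount_succ_succ_of_mem (by omega) hm]
      · intro e he
        rcases Finset.mem_insert.1 he with rfl | he
        · simp only; omega
        · have := hrect e he; omega
    · have hle := hgood a b (by omega) (by omega) (by omega) hm
      by_cases hθ : rayLabel T false a b < θ
      · obtain ⟨C, hC, hp, hcard, hrect⟩ := ih (a + (b + 1)) (by omega) (a := a) (b := b + 1)
          (by omega) (by omega) (fun x y hx hy hy' => hgood x y (by omega) hy (by omega)) rfl
        refine ⟨C, hC, hp, ?_, fun e he => by have := hrect e he; omega⟩
        rw [hcard, escapeCount_succ_left, rayLabel_below_succ, if_neg hm, if_neg (by omega),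
          add_zero]
      · obtain ⟨C, hC, hp, hcard, hrect⟩ := ih (a + 1 + b) (by omega) (a := a + 1) (b := b)
          (by omega) (by omega) (fun x y hx hy hy' => hgood x y (by omega) hy (by omega)) rfl
        refine ⟨C, hC, hp, ?_, fun e he => by have := hrect e he; omega⟩
        rw [hcard, escapeCount_succ_right (a + 1) (by omega), rayLabel_left_succ, if_neg hm,
          if_neg hθ, add_zero]

end EscapeCount

/-! ### Rays of a `k`-triangulation cross at most once -/

section Reduced

variable {n k : ℕ} {T : Finset (ℕ × ℕ)}

/-- In a `k`-triangulation no two rays cross twice: where two rays cross, the one arriving from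
below has started below the other one. Otherwise a mirror could be added at a first point where
this fails, since the crossings through that point can be rerouted along existing mirrors. -/
theorem IsKTriangulation.rayLabel_below_le_left (hT : IsKTriangulation n k T) {u v : ℕ}
    (huv : u < v) (hv : v < n) (hm : (u, v) ∉ T) :
    rayLabel T true u v ≤ rayLabel T false u v := by
  induction hs : u + v using Nat.strong_induction_on generalizing u v with
  | _ s ih =>
    subst hs
    by_contra! hbad
    refine hm (hT.mem_of_crossingFree_insert (mem_polygonEdges.2 ⟨huv, hv⟩) fun C hC hp hcard => ?_)
    have huC : (u, v) ∈ C := by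
      by_contra he
      have := hT.crossingFree.card_lt ((Finset.subset_insert_iff_of_notMem he).1 hC) hp
      omega
    -- `C` lies in the quadrant `[0, θ) × [θ, ∞)`.
    obtain ⟨e₀, he₀, hmin⟩ := C.exists_min_image Prod.snd ⟨_, huC⟩
    have hedge : ∀ e ∈ C, e.1 < e.2 := fun e he =>
      (mem_polygonEdges.1 (Finset.insert_subset (mem_polygonEdges.2 ⟨huv, hv⟩) hT.subset
        (hC he))).1
    set θ := e₀.2 with hθ
    have hquad : ∀ e ∈ C, e.1 < θ ∧ θ ≤ e.2 := by
      intro e he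
      refine ⟨?_, hmin e he⟩
      by_cases h : e = e₀
      · rw [h]; exact hedge _ he₀
      · have := hp he he₀ h
        have := hmin e he
        have := hedge e he
        unfold EdgesCross at *
        omega
    have hcomp : ∀ e ∈ C, ∀ f ∈ C, e ≠ f → (e.1 < f.1 ∧ e.2 < f.2) ∨ (f.1 < e.1 ∧ f.2 < e.2) := by
      intro e he f hf h
      have := hp he hf h
      unfold EdgesCross at this
      omega
    have huθ := hquad _ huC
    simp only at huθ
    set C₁ := C.filter fun e => e.1 < u with hC₁
    set C₂ := C.filter fun e => u < e.1 with hC₂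
    have hsplit : C.card = C₁.card + C₂.card + 1 := by
      have h1 : C.erase (u, v) = C₁ ∪ C₂ := by
        ext e
        simp only [hC₁, hC₂, Finset.mem_erase, Finset.mem_union, Finset.mem_filter]
        constructor
        · rintro ⟨hne, he⟩
          have := hcomp e he _ huC hne
          simp only at this
          rcases this with h | h
          · exact Or.inl ⟨he, h.1⟩
          · exact Or.inr ⟨he, h.1⟩
        · rintro (⟨he, h⟩ | ⟨he, h⟩)
          · exact ⟨fun h' => by simp [h'] at h, he⟩
          · exact ⟨fun h' => by simp [h'] at h, he⟩
      have h2 : Disjoint C₁ C₂ := by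
        rw [Finset.disjoint_left]
        intro e h1 h2
        simp only [hC₁, hC₂, Finset.mem_filter] at h1 h2
        omega
      rw [← Finset.card_erase_add_one huC, h1, Finset.card_union_of_disjoint h2]
    have hC₁T : C₁ ⊆ T := by
      intro e he
      obtain ⟨he, h⟩ := Finset.mem_filter.1 he
      rcases Finset.mem_insert.1 (hC he) with rfl | h'
      · simp at h
      · exact h'
    have hC₂T : C₂ ⊆ T := by
      intro e he
      obtain ⟨he, h⟩ := Finset.mem_filter.1 he
      rcases Finset.mem_insert.1 (hC he) with rfl | h'
      · simp at h
      · exact h'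
    have hcount : C₁.card ≤ escapeCount T θ u v := by
      refine card_le_escapeCount hC₁T (hp.mono (by exact_mod_cast Finset.filter_subset _ _))
        huθ.2 fun e he => ?_
      obtain ⟨he, h⟩ := Finset.mem_filter.1 he
      have h1 := hcomp e he _ huC (fun h' => by simp [h'] at h)
      have h2 := hquad e he
      simp only at h1
      omega
    -- As the crossing at `(u, v)` is a repeated one, the count already increases before `(u, v)`.
    have hex : ∃ a b, u ≤ a ∧ v ≤ b ∧ a + b = u + v + 1 ∧ C₁.card + 1 ≤ escapeCount T θ a b := by
      by_cases h : (θ : ℤ) ≤ rayLabel T true u v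
      · refine ⟨u + 1, v, by omega, by omega, by omega, ?_⟩
        rw [escapeCount_succ_left, if_pos h]
        omega
      · refine ⟨u, v + 1, by omega, by omega, by omega, ?_⟩
        rw [escapeCount_succ_right u huθ.2, if_pos (by omega)]
        omega
    obtain ⟨a, b, hua, hvb, hab, hle⟩ := hex
    obtain ⟨D, hD, hDp, hDcard, hDrect⟩ := exists_crossing_card_eq_escapeCount (T := T) (θ := θ)
      (a := a) (b := b) (by omega) (by omega) (fun x y hx hy hyb hxy =>
        ih (x + y) (by omega) (by omega) (by omega) hxy rfl)
    have hC₂q : ∀ f ∈ C₂, u < f.1 ∧ v < f.2 ∧ f.1 < θ := by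
      intro f hf
      obtain ⟨hf, h⟩ := Finset.mem_filter.1 hf
      have h1 := hcomp f hf _ huC (fun h' => by simp [h'] at h)
      have h2 := hquad f hf
      simp only at h1
      omega
    have hlt : ∀ e ∈ D, ∀ f ∈ C₂, e.1 < f.1 ∧ f.1 < e.2 ∧ e.2 < f.2 := by
      intro e he f hf
      have h1 := hDrect e he
      have h2 := hC₂q f hf
      omega
    have hdisj : Disjoint D C₂ := by
      rw [Finset.disjoint_left]
      intro e h1 h2
      have := hlt e h1 e h2
      omega
    have hfin := hT.crossingFree.card_lt (C := D ∪ C₂) (Finset.union_subset hD hC₂T) (by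
      rw [Finset.coe_union, Set.pairwise_union]
      refine ⟨hDp, hp.mono (by exact_mod_cast Finset.filter_subset _ _), ?_⟩
      intro e he f hf _
      have := hlt e he f hf
      exact ⟨Or.inl this, Or.inr this⟩)
    rw [Finset.card_union_of_disjoint hdisj] at hfin
    omega

theorem IsKTriangulation.escapeCount_le (hT : IsKTriangulation n k T) {θ a b : ℕ} (ha : a ≤ θ)
    (hθ : θ ≤ b) (hb : b ≤ n) : escapeCount T θ a b ≤ k := by
  obtain ⟨C, hC, hp, hcard, -⟩ := exists_crossing_card_eq_escapeCount (T := T) ha hθ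
    fun x y hx hy hyb hxy => hT.rayLabel_below_le_left (by omega) (by omega) hxy
  have := hT.crossingFree.card_lt hC hp
  omega

end Reduced

/-! ### The ends of the beams -/

section MiddleBeams

variable {n k : ℕ} {T : Finset (ℕ × ℕ)}

/-- Above the diagonal there are only rays that come from the left. -/
theorem IsKTriangulation.rayLabel_nonneg (hT : IsKTriangulation n k T) (hk : 1 ≤ k) (x y : ℕ)
    (hy : y ≤ n) : (x < y → y < n → 0 ≤ rayLabel T false x y) ∧
      (x + 1 < y → 0 ≤ rayLabel T true x y) := by
  induction hs : x + y using Nat.strong_induction_on generalizing x y with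
  | _ s ih =>
    subst hs
    constructor
    · intro hxy hyn
      cases x with
      | zero => rw [rayLabel_left_zero]; omega
      | succ x =>
        rw [rayLabel_left_succ]
        have := ih (x + y) (by omega) x y (by omega) rfl
        split_ifs
        · exact this.2 (by omega)
        · exact this.1 (by omega) hyn
    · intro hxy
      cases y with
      | zero => omega
      | succ y =>
        rw [rayLabel_below_succ]
        have := ih (x + y) (by omega) x y (by omega) rfl
        split_ifs with hm
        · exact this.1 (by omega) (by omega)
        · refine this.2 ?_
          rcases Nat.lt_or_ge (x + 1) y with h | h
          · exact h
          · exact absurd (hT.mem_of_short (by omega) (by omega) (Or.inl (by omega))) hm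

/-- The rays coming from the rows `1, …, k - 1` and `n - k, …, n - 1` are reflected at each grid
point, since they only meet edges that belong to every `k`-triangulation. -/
theorem IsKTriangulation.rayLabel_outer (hT : IsKTriangulation n k T) {j : ℕ} (hj : 1 ≤ j)
    (hjk : j + 1 ≤ k ∨ n ≤ j + k) (x : ℕ) (hx : x + j < n) :
    rayLabel T false x (x + j) = j ∧ rayLabel T true x (x + j + 1) = j := by
  induction x with
  | zero =>
    have h0 : rayLabel T false 0 (0 + j) = j := by rw [rayLabel_left_zero]; simp
    refine ⟨h0, ?_⟩
    rw [rayLabel_below_succ, if_pos (hT.mem_of_short (by omega) (by omega) (by omega)), h0]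
  | succ x ih =>
    have h0 : rayLabel T false (x + 1) (x + 1 + j) = j := by
      rw [rayLabel_left_succ, if_pos (hT.mem_of_short (by omega) (by omega) (by omega)),
        show x + 1 + j = x + j + 1 by omega]
      exact (ih (by omega)).2
    refine ⟨h0, ?_⟩
    rw [rayLabel_below_succ, if_pos (hT.mem_of_short (by omega) (by omega) (by omega)), h0]

theorem rayLabel_row_zero (hT : T ⊆ polygonEdges n) (x : ℕ) : rayLabel T false x 0 = 0 := by
  induction x with
  | zero => simp [rayLabel_left_zero]
  | succ x ih =>
    rw [rayLabel_left_succ, if_neg, ih]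
    intro h
    have := mem_polygonEdges.1 (hT h)
    simp at this

theorem rayLabel_below_ne_zero (hT : T ⊆ polygonEdges n) (x y : ℕ) : rayLabel T true x y ≠ 0 := by
  intro h
  have hy : 0 < y := by
    have := rayLabel_below_lt (T := T) x y
    omega
  obtain ⟨t, ht⟩ := (rayLabel_eq_iff T 0 _ _ _).1 h
  obtain ⟨t', ht'⟩ := (rayLabel_eq_iff T 0 _ _ _).1 (rayLabel_row_zero hT (x + 1))
  rcases lt_trichotomy t t' with hlt | rfl | hlt
  · have := (beam_coords_of_lt T 0 hlt).2
    simp [ht, ht'] at this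
    omega
  · rw [ht] at ht'; simp at ht'
  · have := (beam_coords_of_lt T 0 hlt).1
    simp [ht, ht'] at this

/-- The ray that leaves the polygon upwards in the middle column `x` comes from the row `x`. It does
not come from a higher row, as together with the rays from the `k` highest rows this would be more
than `k` rays from the rows above `x` in the columns up to `x`. The rays from the lower rows
leave in other columns. -/
theorem IsKTriangulation.rayLabel_top (hT : IsKTriangulation n k T) (hk : 1 ≤ k)
    {x : ℕ} (hkx : k ≤ x) (hxn : x + k < n) : rayLabel T true x n = x := by
  induction x using Nat.strong_induction_on with
  | _ x ih =>
    have hle : rayLabel T true x n ≤ x := by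
      by_contra! hlt
      have h1 := hT.escapeCount_le (θ := x + 1) (a := x + 1) (b := n) le_rfl (by omega) le_rfl
      have h2 : (insert x (Finset.range k)).card ≤ escapeCount T (x + 1) (x + 1) n := by
        refine Finset.card_le_card fun z hz => ?_
        rw [Finset.mem_filter, Finset.mem_range]
        rcases Finset.mem_insert.1 hz with rfl | hz
        · push_cast; omega
        · rw [Finset.mem_range] at hz
          have h3 := (hT.rayLabel_outer (j := n - 1 - z) (by omega) (by omega) z (by omega)).2
          rw [show z + (n - 1 - z) + 1 = n by omega] at h3
          rw [h3]
          push_cast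
          omega
      rw [Finset.card_insert_of_notMem (by simpa using hkx), Finset.card_range] at h2
      omega
    obtain ⟨m, hm⟩ := Int.eq_ofNat_of_zero_le ((hT.rayLabel_nonneg hk x n le_rfl).2 (by omega))
    rw [hm] at hle ⊢
    have hm0 : m ≠ 0 := by
      rintro rfl
      exact rayLabel_below_ne_zero hT.subset x n (by exact_mod_cast hm)
    by_contra hne
    have hmx : m < x := by omega
    rcases Nat.lt_or_ge m k with hmk | hmk
    · have h3 := (hT.rayLabel_outer (j := m) (by omega) (by omega) (n - 1 - m) (by omega)).2
      rw [show n - 1 - m + m + 1 = n by omega] at h3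
      have := rayLabel_below_inj hm h3
      omega
    · have := rayLabel_below_inj hm (ih m hmx hmk (by omega))
      omega

theorem IsKTriangulation.exists_row (hT : IsKTriangulation n k T) (hk : 1 ≤ k)
    {h a : ℕ} (hkh : k ≤ h) (hhn : h + k < n) (ha : a < h) :
    ∃ y, h ≤ y ∧ y < n ∧ rayLabel T false (a + 1) y = h :=
  exists_rayLabel_left_eq (hT.rayLabel_top hk hkh hhn) ha

theorem IsKTriangulation.lt_of_row (hT : IsKTriangulation n k T) (hk : 1 ≤ k)
    {h a y : ℕ} (hkh : k ≤ h) (hhn : h + k < n) (hy : rayLabel T false (a + 1) y = h)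
    (hyn : y < n) : a < h :=
  lt_of_rayLabel_left_eq (hT.rayLabel_top hk hkh hhn) hy hyn

/-- The rows of a vertical strip that are occupied by the middle beams. They do not depend on the
`k`-triangulation. -/
theorem IsKTriangulation.exists_middle_iff (hT : IsKTriangulation n k T) (hk : 1 ≤ k)
    {a y : ℕ} (hay : a + 1 < y) (hyn : y < n) :
    (∃ h : ℕ, k ≤ h ∧ h + k < n ∧ rayLabel T false (a + 1) y = h) ↔
      a + 1 + k ≤ y ∧ y + k < n + a + 1 := by
  constructor
  · rintro ⟨h, hkh, hhn, hl⟩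
    by_contra hcon
    have h3 := (hT.rayLabel_outer (j := y - (a + 1)) (by omega) (by omega) (a + 1) (by omega)).1
    rw [show a + 1 + (y - (a + 1)) = y by omega, hl] at h3
    omega
  · rintro ⟨h1, h2⟩
    obtain ⟨m, hm⟩ := Int.eq_ofNat_of_zero_le ((hT.rayLabel_nonneg hk (a + 1) y hyn.le).1 hay hyn)
    have hmy : m ≤ y := le_of_rayLabel_eq hm
    refine ⟨m, ?_, ?_, hm⟩
    · by_contra! hlt
      rcases Nat.eq_zero_or_pos m with rfl | hm0
      · have := rayLabel_left_inj hm (by exact_mod_cast rayLabel_row_zero hT.subset (a + 1))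
        omega
      · have h3 := (hT.rayLabel_outer (j := m) (by omega) (by omega) (a + 1) (by omega)).1
        have := rayLabel_left_inj hm h3
        omega
    · by_contra! hlt
      rcases Nat.lt_or_ge (a + 1 + m) n with h | h
      · have h3 := (hT.rayLabel_outer (j := m) (by omega) (by omega) (a + 1) (by omega)).1
        have := rayLabel_left_inj hm h3
        omega
      · -- The ray `m` has left the polygon upwards before the column `a + 1`.
        have h3 := (hT.rayLabel_outer (j := m) (by omega) (by omega) (n - 1 - m) (by omega)).2
        rw [show n - 1 - m + m + 1 = n by omega] at h3
        have := lt_of_rayLabel_left_eq h3 hm hyn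
        omega

end MiddleBeams

/-! ### Beams above a unit square -/

section Squares

variable {n k : ℕ} {T : Finset (ℕ × ℕ)}

theorem squareBelowBeam_iff (T : Finset (ℕ × ℕ)) (h a b : ℕ) :
    SquareBelowBeam T h a b ↔ ∃ y, b + 1 ≤ y ∧ rayLabel T false (a + 1) y = h := by
  constructor
  · rintro ⟨t, h1, h2, h3⟩
    refine ⟨_, h3, (rayLabel_eq_iff T h _ _ _).2 ⟨t, ?_⟩⟩
    ext <;> simp [h1, h2]
  · rintro ⟨y, hy, hl⟩
    obtain ⟨t, ht⟩ := (rayLabel_eq_iff T h _ _ _).1 hl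
    exact ⟨t, by simp [ht], by simp [ht], by simpa [ht] using hy⟩

open Classical in
/-- The beams coming from the rows `h ∈ S` that have the unit square with lower left corner `(a, b)`
in their box and below them. -/
noncomputable def beamsAbove (T : Finset (ℕ × ℕ)) (S : Finset ℕ) (a b : ℕ) : Finset ℕ :=
  S.filter fun h => a < h ∧ h ≤ b ∧ SquareBelowBeam T h a b

theorem mem_beamsAbove {S : Finset ℕ} {a b h : ℕ} : h ∈ beamsAbove T S a b ↔
    h ∈ S ∧ a < h ∧ h ≤ b ∧ ∃ y, b + 1 ≤ y ∧ rayLabel T false (a + 1) y = h := by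
  classical
  rw [beamsAbove, Finset.mem_filter, squareBelowBeam_iff]

theorem sum_beamArea_eq {S : Finset ℕ} (hS : ∀ h ∈ S, h < n) :
    ∑ h ∈ S, beamArea n T h =
      ∑ s ∈ Finset.range n ×ˢ Finset.range (n - 1), (beamsAbove T S s.1 s.2).card := by
  classical
  simp only [beamArea, beamsAbove, Finset.card_filter]
  rw [Finset.sum_comm]
  refine Finset.sum_congr rfl fun h hh => ?_
  rw [← Finset.sum_filter, ← Finset.sum_filter]
  refine Finset.sum_congr ?_ fun _ _ => rfl
  ext s
  have := hS h hh
  simp only [Finset.mem_filter, Finset.mem_product, Finset.mem_range, Finset.mem_Ico]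
  constructor
  · rintro ⟨⟨h1, h2, h3⟩, h4⟩
    exact ⟨⟨by omega, by omega⟩, h1, h2, h4⟩
  · rintro ⟨⟨h1, h2⟩, h3, h4, h5⟩
    exact ⟨⟨h3, h4, h2⟩, h5⟩

theorem beamsAbove_union {S S' : Finset ℕ} (a b : ℕ) :
    beamsAbove T (S ∪ S') a b = beamsAbove T S a b ∪ beamsAbove T S' a b := by
  classical
  simp only [beamsAbove, Finset.filter_union]

/-- The number of middle beams above a given unit square is the same for all `k`-triangulations:
they are, apart from the beams coming from higher rows, the beams in the middle rows of the strip
over the square. -/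
theorem IsKTriangulation.card_beamsAbove_eq {T' : Finset (ℕ × ℕ)} (hT : IsKTriangulation n k T)
    (hT' : IsKTriangulation n k T') (hk : 1 ≤ k) {a b : ℕ} (hab : a < b) :
    (beamsAbove T (Finset.Ico k (n - k)) a b).card =
      (beamsAbove T' (Finset.Ico k (n - k)) a b).card := by
  have key : ∀ T, IsKTriangulation n k T →
      (beamsAbove T (Finset.Ico k (n - k)) a b).card +
        ((Finset.Ico k (n - k)).filter (b < ·)).card =
      ((Finset.Ico (b + 1) n).filter fun y => a + 1 + k ≤ y ∧ y + k < n + a + 1).card := by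
    intro T hT
    rw [← Finset.card_union_of_disjoint]
    · symm
      refine Finset.card_nbij (fun y => (rayLabel T false (a + 1) y).toNat) ?_ ?_ ?_
      · intro y hy
        simp only [Finset.coe_filter, Set.mem_ofPred_eq, Finset.mem_Ico] at hy
        obtain ⟨h, h1, h2, h3⟩ := (hT.exists_middle_iff hk (by omega) hy.1.2).2 hy.2
        simp only [h3, Int.toNat_natCast, Finset.coe_union, Set.mem_union, Finset.mem_coe,
          mem_beamsAbove, Finset.mem_filter, Finset.mem_Ico]
        have := hT.lt_of_row hk h1 h2 h3 hy.1.2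
        rcases Nat.lt_or_ge b h with hb | hb
        · exact Or.inr (by omega)
        · exact Or.inl ⟨by omega, by omega, hb, y, by omega, h3⟩
      · intro y hy y' hy' heq
        simp only [Finset.coe_filter, Set.mem_ofPred_eq, Finset.mem_Ico] at hy hy'
        obtain ⟨h, h1, h2, h3⟩ := (hT.exists_middle_iff hk (by omega) hy.1.2).2 hy.2
        obtain ⟨h', h1', h2', h3'⟩ := (hT.exists_middle_iff hk (by omega) hy'.1.2).2 hy'.2
        simp only [h3, h3', Int.toNat_natCast] at heq
        subst heq
        exact rayLabel_left_inj h3 h3'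
      · intro h hh
        simp only [Finset.coe_union, Set.mem_union, Finset.mem_coe,
          mem_beamsAbove, Finset.mem_filter, Finset.mem_Ico] at hh
        have hmid : k ≤ h ∧ h + k < n ∧ a < h := by omega
        obtain ⟨y, h1, h2, h3⟩ := hT.exists_row hk hmid.1 hmid.2.1 hmid.2.2
        have hby : b + 1 ≤ y := by
          rcases hh with ⟨-, -, -, y', h4, h5⟩ | hh
          · rwa [rayLabel_left_inj h3 h5]
          · omega
        refine ⟨y, ?_, by simp [h3]⟩
        simp only [Finset.coe_filter, Set.mem_ofPred_eq, Finset.mem_Ico]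
        exact ⟨⟨hby, h2⟩, (hT.exists_middle_iff hk (by omega) h2).1 ⟨h, hmid.1, hmid.2.1, h3⟩⟩
    · rw [Finset.disjoint_left]
      intro h h1 h2
      rw [mem_beamsAbove] at h1
      rw [Finset.mem_filter] at h2
      omega
  have h1 := key T hT
  have h2 := key T' hT'
  omega

end Squares

/-! ### The edge sets `D(σ)` -/

section StepEdges

/-- The edges of the `n`-gon that join a vertex outside of `S` to the `k`-th vertex outside of `S`
after it. For the set `S` of the positions of the ones in `0^k σ 0^k` this is `D(σ)`. -/
def stepEdges (n k : ℕ) (S : Finset ℕ) : Finset (ℕ × ℕ) :=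
  (polygonEdges n).filter fun e =>
    e.1 ∉ S ∧ e.2 ∉ S ∧ (Finset.Ioo e.1 e.2 \ S).card + 1 = k

variable {n k : ℕ} {S : Finset ℕ}

theorem mem_stepEdges {e : ℕ × ℕ} : e ∈ stepEdges n k S ↔
    (e.1 < e.2 ∧ e.2 < n) ∧ e.1 ∉ S ∧ e.2 ∉ S ∧ (Finset.Ioo e.1 e.2 \ S).card + 1 = k := by
  rw [stepEdges, Finset.mem_filter, mem_polygonEdges]

theorem stepEdges_subset : stepEdges n k S ⊆ polygonEdges n := Finset.filter_subset _ _

theorem infinite_notMem (S : Finset ℕ) : {x | x ∉ S}.Infinite :=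
  S.finite_toSet.infinite_compl

theorem card_Ioo_nth_sdiff (S : Finset ℕ) (i j : ℕ) :
    (Finset.Ioo (Nat.nth (· ∉ S) i) (Nat.nth (· ∉ S) j) \ S).card = j - i - 1 := by
  have hmono := Nat.nth_strictMono (infinite_notMem S)
  rw [← Nat.card_Ioo, ← Finset.card_image_of_injective (Finset.Ioo i j) hmono.injective]
  congr 1
  ext x
  simp only [Finset.mem_sdiff, Finset.mem_Ioo, Finset.mem_image]
  constructor
  · rintro ⟨⟨h1, h2⟩, hx⟩
    have hc : Nat.nth (· ∉ S) (Nat.count (· ∉ S) x) = x := Nat.nth_count hx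
    refine ⟨_, ⟨?_, ?_⟩, hc⟩
    · rw [← hc] at h1; exact hmono.lt_iff_lt.1 h1
    · rw [← hc] at h2; exact hmono.lt_iff_lt.1 h2
  · rintro ⟨l, ⟨h1, h2⟩, rfl⟩
    exact ⟨⟨hmono h1, hmono h2⟩, Nat.nth_mem_of_infinite (infinite_notMem S) l⟩

theorem mem_stepEdges_iff_exists_nth (hk : 1 ≤ k) {e : ℕ × ℕ} : e ∈ stepEdges n k S ↔
    ∃ i, e = (Nat.nth (· ∉ S) i, Nat.nth (· ∉ S) (i + k)) ∧ e.2 < n := by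
  have hmono := Nat.nth_strictMono (infinite_notMem S)
  rw [mem_stepEdges]
  constructor
  · rintro ⟨⟨h1, h2⟩, h3, h4, h5⟩
    have hc1 : Nat.nth (· ∉ S) (Nat.count (· ∉ S) e.1) = e.1 := Nat.nth_count h3
    have hc2 : Nat.nth (· ∉ S) (Nat.count (· ∉ S) e.2) = e.2 := Nat.nth_count h4
    rw [← hc1, ← hc2, card_Ioo_nth_sdiff] at h5
    have h6 : Nat.count (· ∉ S) e.1 < Nat.count (· ∉ S) e.2 := by
      rw [← hmono.lt_iff_lt, hc1, hc2]; exact h1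
    refine ⟨Nat.count (· ∉ S) e.1, ?_, h2⟩
    rw [show Nat.count (· ∉ S) e.1 + k = Nat.count (· ∉ S) e.2 by omega, hc1, hc2]
  · rintro ⟨i, rfl, h⟩
    refine ⟨⟨hmono (by omega), h⟩, Nat.nth_mem_of_infinite (infinite_notMem S) _,
      Nat.nth_mem_of_infinite (infinite_notMem S) _, ?_⟩
    rw [card_Ioo_nth_sdiff]
    omega

theorem le_count_notMem (hS : S ⊆ Finset.Ico k (n - k)) {x : ℕ} (hx : k ≤ x) :
    k ≤ Nat.count (· ∉ S) x := by
  rw [Nat.count_eq_card_filter_range]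
  conv_lhs => rw [← Finset.card_range k]
  refine Finset.card_le_card fun z hz => ?_
  simp only [Finset.mem_filter, Finset.mem_range] at hz ⊢
  refine ⟨by omega, fun h => ?_⟩
  have := Finset.mem_Ico.1 (hS h)
  omega

theorem count_notMem_add_le (hS : S ⊆ Finset.Ico k (n - k)) {x : ℕ} (hx : x + k ≤ n) :
    Nat.count (· ∉ S) x + k ≤ Nat.count (· ∉ S) n := by
  rw [Nat.count_eq_card_filter_range, Nat.count_eq_card_filter_range]
  have h1 : k = (Finset.Ico (n - k) n).card := by rw [Nat.card_Ico]; omega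
  conv_lhs => rw [h1]
  rw [← Finset.card_union_of_disjoint]
  · refine Finset.card_le_card fun z hz => ?_
    simp only [Finset.mem_union, Finset.mem_filter, Finset.mem_range, Finset.mem_Ico] at hz ⊢
    rcases hz with hz | hz
    · exact ⟨by omega, hz.2⟩
    · refine ⟨hz.2, fun h => ?_⟩
      have := Finset.mem_Ico.1 (hS h)
      omega
  · rw [Finset.disjoint_left]
    intro z h1 h2
    simp only [Finset.mem_filter, Finset.mem_range, Finset.mem_Ico] at h1 h2
    omega

theorem exists_stepEdges_right (hk : 1 ≤ k) (hS : S ⊆ Finset.Ico k (n - k)) {v : ℕ}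
    (hv : v ∉ S) (hkv : k ≤ v) (hvn : v < n) : ∃ u, (u, v) ∈ stepEdges n k S := by
  have h1 := le_count_notMem hS hkv
  refine ⟨Nat.nth (· ∉ S) (Nat.count (· ∉ S) v - k),
    (mem_stepEdges_iff_exists_nth hk).2 ⟨Nat.count (· ∉ S) v - k, ?_, hvn⟩⟩
  rw [Nat.sub_add_cancel h1, Nat.nth_count hv]

theorem exists_stepEdges_left (hk : 1 ≤ k) (hS : S ⊆ Finset.Ico k (n - k)) {v : ℕ}
    (hv : v ∉ S) (hvn : v + k < n) : ∃ y, (v, y) ∈ stepEdges n k S := by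
  have h1 := count_notMem_add_le hS (x := v + 1) (by omega)
  rw [Nat.count_succ, if_pos hv] at h1
  refine ⟨Nat.nth (· ∉ S) (Nat.count (· ∉ S) v + k),
    (mem_stepEdges_iff_exists_nth hk).2 ⟨Nat.count (· ∉ S) v, ?_,
      Nat.nth_lt_of_lt_count (by omega)⟩⟩
  rw [Nat.nth_count hv]

/-- Each `s ∈ S` lies below exactly `k` edges of `stepEdges n k S`; at least `k` is what matters. -/
theorem le_card_stepEdges_filter (hk : 1 ≤ k) (hS : S ⊆ Finset.Ico k (n - k)) {s : ℕ}
    (hs : s ∈ S) : k ≤ ((stepEdges n k S).filter fun e => e.1 < s ∧ s < e.2).card := by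
  have hmono := Nat.nth_strictMono (infinite_notMem S)
  have hsk := Finset.mem_Ico.1 (hS hs)
  set m := Nat.count (· ∉ S) s with hm
  have hkm : k ≤ m := le_count_notMem hS hsk.1
  have hmn : m + k ≤ Nat.count (· ∉ S) n := count_notMem_add_le hS (by omega)
  have hinj : Function.Injective fun i => (Nat.nth (· ∉ S) i, Nat.nth (· ∉ S) (i + k)) := by
    intro i j hij
    exact hmono.injective (Prod.ext_iff.1 hij).1
  calc k = (Finset.Ico (m - k) m).card := by rw [Nat.card_Ico]; omega
    _ = ((Finset.Ico (m - k) m).image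
        fun i => (Nat.nth (· ∉ S) i, Nat.nth (· ∉ S) (i + k))).card :=
      (Finset.card_image_of_injective _ hinj).symm
    _ ≤ _ := by
      refine Finset.card_le_card fun e he => ?_
      obtain ⟨i, hi, rfl⟩ := Finset.mem_image.1 he
      rw [Finset.mem_Ico] at hi
      rw [Finset.mem_filter, mem_stepEdges_iff_exists_nth hk]
      refine ⟨⟨i, rfl, Nat.nth_lt_of_lt_count (by omega)⟩, Nat.nth_lt_of_lt_count hi.2, ?_⟩
      have h1 : s ≤ Nat.nth (· ∉ S) (i + k) := (Nat.count_le_iff_le_nth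
        (infinite_notMem S)).1 (by omega)
      have h2 : Nat.nth (· ∉ S) (i + k) ∉ S :=
        Nat.nth_mem_of_infinite (infinite_notMem S) (i + k)
      exact lt_of_le_of_ne h1 (ne_of_mem_of_not_mem hs h2)

theorem stepEdges_lt_iff (hk : 1 ≤ k) {e f : ℕ × ℕ} (he : e ∈ stepEdges n k S)
    (hf : f ∈ stepEdges n k S) (hne : e ≠ f) :
    (e.1 < f.1 ∧ e.2 < f.2) ∨ (f.1 < e.1 ∧ f.2 < e.2) := by
  have hmono := Nat.nth_strictMono (infinite_notMem S)
  obtain ⟨i, rfl, -⟩ := (mem_stepEdges_iff_exists_nth hk).1 he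
  obtain ⟨j, rfl, -⟩ := (mem_stepEdges_iff_exists_nth hk).1 hf
  rcases lt_trichotomy i j with h | rfl | h
  · exact Or.inl ⟨hmono h, hmono (by omega)⟩
  · exact absurd rfl hne
  · exact Or.inr ⟨hmono h, hmono (by omega)⟩

/-- An edge from `s ∈ S` that passes over at least `k` vertices outside of `S` forms a
`(k + 1)`-crossing with the edges of `stepEdges n k S` above `s`. -/
theorem notMem_of_stepEdges_subset {T : Finset (ℕ × ℕ)} (hk : 1 ≤ k)
    (hS : S ⊆ Finset.Ico k (n - k)) (hT : CrossingFree (k + 1) T) (hD : stepEdges n k S ⊆ T)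
    {u v : ℕ} (hZ : k ≤ (Finset.Ioo u v \ S).card) (huv : u ∈ S ∨ v ∈ S) :
    (u, v) ∉ T := by
  intro hmem
  have huv' : u < v := by
    by_contra! h
    rw [Finset.Ioo_eq_empty (by omega)] at hZ
    simp at hZ
    omega
  obtain ⟨s, hs, hsuv⟩ : ∃ s ∈ S, s = u ∨ s = v := by
    rcases huv with h | h
    · exact ⟨_, h, Or.inl rfl⟩
    · exact ⟨_, h, Or.inr rfl⟩
  set C := (stepEdges n k S).filter fun e => e.1 < s ∧ s < e.2 with hC
  have hcard : k ≤ C.card := le_card_stepEdges_filter hk hS hs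
  have hcross : ∀ e ∈ C, EdgesCross (u, v) e := by
    intro e he
    obtain ⟨he, h1, h2⟩ := Finset.mem_filter.1 he
    obtain ⟨-, h3, h4, h5⟩ := mem_stepEdges.1 he
    have hnot : ¬ (e.1 ≤ u ∧ v ≤ e.2) := by
      rintro ⟨h6, h7⟩
      have := Finset.card_le_card (Finset.sdiff_subset_sdiff
        (Finset.Ioo_subset_Ioo h6 h7) (subset_refl S))
      omega
    unfold EdgesCross
    simp only
    omega
  have hnot : (u, v) ∉ C := fun h => by
    have := hcross _ h
    simp [EdgesCross] at this
  have := hT.card_lt (C := insert (u, v) C)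
    (Finset.insert_subset hmem ((Finset.filter_subset _ _).trans hD)) (by
      rw [Finset.coe_insert]
      refine Set.Pairwise.insert ?_ fun e he _ => ⟨hcross e he, (hcross e he).symm⟩
      intro e he f hf hne
      obtain ⟨he, h1, h2⟩ := Finset.mem_filter.1 he
      obtain ⟨hf, h3, h4⟩ := Finset.mem_filter.1 hf
      have := stepEdges_lt_iff hk he hf hne
      unfold EdgesCross
      omega)
  rw [Finset.card_insert_of_notMem hnot] at this
  omega

/-- For a chain of sets `S`, the edges in all `stepEdges n k S` together contain no
`(k + 1)`-crossing. Indeed, an edge of such a crossing that comes from the smallest of the sets `S`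
would pass over `k` endpoints of the others, and these all lie outside of this `S`. -/
theorem exists_isKTriangulation_of_isChain {𝒮 : Set (Finset ℕ)}
    (hchain : IsChain (· ⊆ ·) 𝒮) :
    ∃ T, IsKTriangulation n k T ∧ ∀ S ∈ 𝒮, stepEdges n k S ⊆ T := by
  classical
  set E := (polygonEdges n).filter fun e => ∃ S ∈ 𝒮, e ∈ stepEdges n k S with hE
  have hcf : CrossingFree (k + 1) E := by
    intro C hC hp hcard
    have hch : ∀ e ∈ C, ∃ S ∈ 𝒮, e ∈ stepEdges n k S := fun e he =>
      (Finset.mem_filter.1 (hC he)).2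
    choose! f hf𝒮 hf using hch
    obtain ⟨e, he, hmin⟩ := C.exists_min_image (fun e => (f e).card)
      (Finset.card_pos.1 (by omega))
    have hsub : ∀ g ∈ C, f e ⊆ f g := by
      intro g hg
      rcases hchain.total (hf𝒮 e he) (hf𝒮 g hg) with h | h
      · exact h
      · rw [Finset.eq_of_subset_of_card_le h (hmin g hg)]
    have h1 := card_le_card_inter_Ioo_add_one (W := Finset.range n \ f e) hp he fun g hg => by
      obtain ⟨h1, h2, h3, -⟩ := mem_stepEdges.1 (hf g hg)
      simp only [Finset.mem_sdiff, Finset.mem_range]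
      exact ⟨⟨by omega, fun h => h2 (hsub g hg h)⟩, ⟨by omega, fun h => h3 (hsub g hg h)⟩⟩
    obtain ⟨-, -, -, h2⟩ := mem_stepEdges.1 (hf e he)
    have h3 : ((Finset.range n \ f e) ∩ Finset.Ioo e.1 e.2).card ≤
        (Finset.Ioo e.1 e.2 \ f e).card := by
      refine Finset.card_le_card fun x hx => ?_
      simp only [Finset.mem_inter, Finset.mem_sdiff] at hx ⊢
      exact ⟨hx.2, hx.1.2⟩
    omega
  have hfin : {S : Finset (ℕ × ℕ) | S ⊆ polygonEdges n ∧ CrossingFree (k + 1) S}.Finite :=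
    (Finset.finite_toSet (polygonEdges n).powerset).subset fun S hS => by
      simpa using hS.1
  obtain ⟨T, hET, hT⟩ := hfin.exists_le_maximal (a := E) ⟨Finset.filter_subset _ _, hcf⟩
  refine ⟨T, hT, fun S hS e he => hET ?_⟩
  exact Finset.mem_filter.2 ⟨stepEdges_subset he, S, hS, he⟩

end StepEdges

/-! ### Minimal area below the beams -/

section Separation

variable {n k : ℕ} {S : Finset ℕ} {T : Finset (ℕ × ℕ)}

/-- The labels of the rays that stay below the staircase with corners `stepEdges n k S`: those of
the rows in `S`, and those of the outer rays close to the diagonal. -/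
def IsLowLabel (k : ℕ) (S : Finset ℕ) (l : ℤ) : Prop := l < k ∨ ∃ s ∈ S, l = (s : ℕ)

/-- The labels of the rays that stay above the staircase with corners `stepEdges n k S`. -/
def IsHighLabel (k : ℕ) (S : Finset ℕ) (l : ℤ) : Prop := ∃ z : ℕ, k ≤ z ∧ z ∉ S ∧ l = z

/-- The constraint on the ray that arrives at `(x, y)` from the left. It arrives from above the
staircase if and only if at least `k` vertices in `[x, y)` are outside of `S`. -/
def LeftSeparated (k : ℕ) (S : Finset ℕ) (T : Finset (ℕ × ℕ)) (x y : ℕ) : Prop :=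
  ((Finset.Ico x y \ S).card < k → IsLowLabel k S (rayLabel T false x y)) ∧
  (k ≤ (Finset.Ico x y \ S).card →
    (y ∈ S → rayLabel T false x y = y) ∧ (y ∉ S → IsHighLabel k S (rayLabel T false x y)))

/-- The constraint on the ray that arrives at `(x, y)` from below. It arrives from above the
staircase if and only if at least `k` vertices in `(x, y)` are outside of `S`. -/
def BelowSeparated (k : ℕ) (S : Finset ℕ) (T : Finset (ℕ × ℕ)) (x y : ℕ) : Prop :=
  ((Finset.Ioo x y \ S).card < k → IsLowLabel k S (rayLabel T true x y)) ∧
  (k ≤ (Finset.Ioo x y \ S).card →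
    (x ∈ S → IsLowLabel k S (rayLabel T true x y)) ∧
    (x ∉ S → IsHighLabel k S (rayLabel T true x y)))

theorem card_Ico_sdiff_eq (S : Finset ℕ) (x y : ℕ) : (Finset.Ico x y \ S).card =
    (Finset.Ioo x y \ S).card + if x < y ∧ x ∉ S then 1 else 0 := by
  rcases Nat.lt_or_ge x y with h | h
  · rw [← Finset.Ioo_insert_left h]
    by_cases hx : x ∈ S
    · simp [Finset.insert_sdiff_of_mem _ hx, hx]
    · rw [Finset.insert_sdiff_of_notMem _ hx, Finset.card_insert_of_notMem (by simp)]
      simp [h, hx]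
  · simp [h]

theorem card_Ioc_sdiff_eq (S : Finset ℕ) (x y : ℕ) : (Finset.Ioc x y \ S).card =
    (Finset.Ioo x y \ S).card + if x < y ∧ y ∉ S then 1 else 0 := by
  rcases Nat.lt_or_ge x y with h | h
  · rw [← Finset.Ioo_insert_right h]
    by_cases hx : y ∈ S
    · simp [Finset.insert_sdiff_of_mem _ hx, hx]
    · rw [Finset.insert_sdiff_of_notMem _ hx, Finset.card_insert_of_notMem (by simp)]
      simp [h, hx]
  · simp [h]

/-- The constraints are inherited along the rays: at the corners of the staircase there are
mirrors, and above the staircase there are none in the rows and columns that belong to `S`. -/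
theorem LeftSeparated.step (hk : 1 ≤ k) (hS : S ⊆ Finset.Ico k (n - k))
    (hT : IsKTriangulation n k T) (hD : stepEdges n k S ⊆ T) {x y : ℕ} (hy : y < n)
    (hl : LeftSeparated k S T x y) (hb : BelowSeparated k S T x y) :
    LeftSeparated k S T (x + 1) y ∧ BelowSeparated k S T x (y + 1) := by
  unfold LeftSeparated BelowSeparated at *
  have e1 : Finset.Ico (x + 1) y = Finset.Ioo x y := by ext; simp
  have e2 : Finset.Ioo x (y + 1) = Finset.Ioc x y := by ext; simp
  have hc1 := card_Ico_sdiff_eq S x y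
  have hc2 := card_Ioc_sdiff_eq S x y
  rw [e1, e2, rayLabel_left_succ, rayLabel_below_succ]
  obtain ⟨hl1, hl2⟩ := hl
  obtain ⟨hb1, hb2⟩ := hb
  have hnot : k ≤ (Finset.Ioo x y \ S).card → x ∈ S ∨ y ∈ S → (x, y) ∉ T :=
    notMem_of_stepEdges_subset hk hS hT.crossingFree hD
  have hcorner : x < y → x ∉ S → y ∉ S → (Finset.Ioo x y \ S).card + 1 = k → (x, y) ∈ T :=
    fun h1 h2 h3 h4 => hD (mem_stepEdges.2 ⟨⟨h1, hy⟩, h2, h3, h4⟩)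
  have hrow : y ∈ S → IsLowLabel k S (y : ℤ) := fun h => Or.inr ⟨y, h, rfl⟩
  generalize rayLabel T false x y = l at *
  generalize rayLabel T true x y = m at *
  generalize (Finset.Ico x y \ S).card = ci at *
  generalize (Finset.Ioc x y \ S).card = cj at *
  have hempty : ¬ x < y → (Finset.Ioo x y \ S).card = 0 := by
    intro h
    simp [Finset.Ioo_eq_empty_of_le (not_lt.1 h)]
  generalize (Finset.Ioo x y \ S).card = c at *
  by_cases hxS : x ∈ S <;> by_cases hyS : y ∈ S <;> by_cases hxy : x < y <;>
    by_cases hm : (x, y) ∈ T <;>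
    simp only [hxS, hyS, hxy, hm, not_true_eq_false, not_false_eq_true, and_true, and_false,
      if_true, if_false, true_implies, false_implies, or_true, or_false, or_self,
      imp_false, not_le] at * <;>
    grind

theorem IsKTriangulation.separated (hk : 1 ≤ k) (hS : S ⊆ Finset.Ico k (n - k))
    (hT : IsKTriangulation n k T) (hD : stepEdges n k S ⊆ T) (x y : ℕ) :
    (y < n → LeftSeparated k S T x y) ∧ (y ≤ n → BelowSeparated k S T x y) := by
  induction hs : x + y using Nat.strong_induction_on generalizing x y with
  | _ s ih =>
    subst hs
    constructor
    · intro hy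
      cases x with
      | zero =>
        unfold LeftSeparated
        rw [rayLabel_left_zero]
        constructor
        · intro h
          refine Or.inl ?_
          by_contra! hle
          have : (Finset.range k).card ≤ (Finset.Ico 0 y \ S).card := by
            refine Finset.card_le_card fun z hz => ?_
            rw [Finset.mem_range] at hz
            rw [Finset.mem_sdiff, Finset.mem_Ico]
            refine ⟨by omega, fun h => ?_⟩
            have := Finset.mem_Ico.1 (hS h)
            omega
          rw [Finset.card_range] at this
          omega
        · intro h
          refine ⟨fun _ => rfl, fun hyS => ⟨y, ?_, hyS, rfl⟩⟩
          have := Finset.card_le_card (Finset.sdiff_subset (s := Finset.Ico 0 y) (t := S))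
          rw [Nat.card_Ico] at this
          omega
      | succ x =>
        have := ih (x + y) (by omega) x y rfl
        exact (LeftSeparated.step hk hS hT hD hy (this.1 hy) (this.2 hy.le)).1
    · intro hy
      cases y with
      | zero =>
        unfold BelowSeparated
        rw [rayLabel_below_zero]
        refine ⟨fun _ => Or.inl (by omega), fun h => ?_⟩
        simp at h
        omega
      | succ y =>
        have := ih (x + y) (by omega) x y rfl
        exact (LeftSeparated.step hk hS hT hD hy (this.1 hy) (this.2 (by omega))).2

theorem IsKTriangulation.beamsAbove_eq_empty (hk : 1 ≤ k) (hS : S ⊆ Finset.Ico k (n - k))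
    (hT : IsKTriangulation n k T) (hD : stepEdges n k S ⊆ T) {a b : ℕ}
    (hab : k ≤ (Finset.Ioc a b \ S).card) : beamsAbove T S a b = ∅ := by
  rw [Finset.eq_empty_iff_forall_notMem]
  intro h hh
  obtain ⟨hhS, hah, hhb, y, hby, hl⟩ := mem_beamsAbove.1 hh
  have hmid := Finset.mem_Ico.1 (hS hhS)
  obtain ⟨y', -, hyn, hl'⟩ := hT.exists_row hk hmid.1 (by omega) hah
  obtain rfl := rayLabel_left_inj hl hl'
  have h1 := ((hT.separated hk hS hD (a + 1) y).1 hyn).2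
  have h2 := h1 (hab.trans (Finset.card_le_card (Finset.sdiff_subset_sdiff (fun z hz => by
    simp only [Finset.mem_Ioc, Finset.mem_Ico] at hz ⊢; omega) (subset_refl S))))
  rw [hl] at h2
  by_cases hy : y ∈ S
  · have := h2.1 hy; omega
  · obtain ⟨z, -, hz, hzh⟩ := h2.2 hy
    exact hz (by rwa [← show h = z by omega])

theorem IsKTriangulation.beamsAbove_sdiff_eq (hk : 1 ≤ k) (hS : S ⊆ Finset.Ico k (n - k))
    (hT : IsKTriangulation n k T) (hD : stepEdges n k S ⊆ T) {a b : ℕ}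
    (hab : (Finset.Ioc a b \ S).card ≤ k) : beamsAbove T (Finset.Ico k (n - k) \ S) a b =
      (Finset.Ico k (n - k) \ S).filter fun h => a < h ∧ h ≤ b := by
  ext h
  rw [mem_beamsAbove, Finset.mem_filter]
  refine ⟨fun hh => ⟨hh.1, hh.2.1, hh.2.2.1⟩, fun ⟨hh, hah, hhb⟩ => ⟨hh, hah, hhb, ?_⟩⟩
  rw [Finset.mem_sdiff, Finset.mem_Ico] at hh
  obtain ⟨y, hhy, hyn, hl⟩ := hT.exists_row hk hh.1.1 (by omega) hah
  refine ⟨y, ?_, hl⟩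
  by_contra! hy
  obtain ⟨h1, h2⟩ := (hT.separated hk hS hD (a + 1) y).1 hyn
  rw [hl] at h1 h2
  have hsub : Finset.Ico (a + 1) y ⊆ Finset.Ioc a b := fun z hz => by
    simp only [Finset.mem_Ioc, Finset.mem_Ico] at hz ⊢; omega
  have hsub' := Finset.sdiff_subset_sdiff hsub (subset_refl S)
  rcases Nat.lt_or_ge (Finset.Ico (a + 1) y \ S).card k with hlt | hge
  · rcases h1 hlt with h1 | ⟨s, hs, h1⟩
    · omega
    · exact hh.2 (by rwa [show h = s by omega])
  · by_cases hyS : y ∈ S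
    · exact hh.2 (by rwa [show h = y by have := (h2 hge).1 hyS; omega])
    · have h3 : y ∈ Finset.Ico (a + 1) y \ S := by
        rw [Finset.eq_of_subset_of_card_le hsub' (hab.trans hge), Finset.mem_sdiff,
          Finset.mem_Ioc]
        exact ⟨by omega, hyS⟩
      simp at h3

theorem beamsAbove_subset_filter {a b : ℕ} :
    beamsAbove T S a b ⊆ S.filter fun h => a < h ∧ h ≤ b := by
  intro h hh
  rw [mem_beamsAbove] at hh
  rw [Finset.mem_filter]
  exact ⟨hh.1, hh.2.1, hh.2.2.1⟩

theorem card_beamsAbove_add (hS : S ⊆ Finset.Ico k (n - k)) (a b : ℕ) :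
    (beamsAbove T S a b).card + (beamsAbove T (Finset.Ico k (n - k) \ S) a b).card =
      (beamsAbove T (Finset.Ico k (n - k)) a b).card := by
  rw [← Finset.card_union_of_disjoint, ← beamsAbove_union, Finset.union_sdiff_of_subset hS]
  rw [Finset.disjoint_left]
  intro h h1 h2
  rw [mem_beamsAbove] at h1 h2
  exact (Finset.mem_sdiff.1 h2.1).2 h1.1

variable {T' : Finset (ℕ × ℕ)}

/-- The number of `S`-beams above each unit square is minimal for the `k`-triangulations that
contain `stepEdges n k S`. -/
theorem IsKTriangulation.card_beamsAbove_le (hk : 1 ≤ k) (hS : S ⊆ Finset.Ico k (n - k))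
    (hT : IsKTriangulation n k T) (hD : stepEdges n k S ⊆ T) (hT' : IsKTriangulation n k T')
    (a b : ℕ) : (beamsAbove T S a b).card ≤ (beamsAbove T' S a b).card := by
  rcases Nat.lt_or_ge (Finset.Ioc a b \ S).card k with h | h
  · have h1 := card_beamsAbove_add (T := T) hS a b
    have h2 := card_beamsAbove_add (T := T') hS a b
    have h3 := Finset.card_le_card
      (beamsAbove_subset_filter (T := T') (S := Finset.Ico k (n - k) \ S) (a := a) (b := b))
    rw [hT.beamsAbove_sdiff_eq hk hS hD h.le] at h1
    rcases Nat.lt_or_ge a b with hab | hab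
    · have h4 := hT.card_beamsAbove_eq hT' hk hab
      omega
    · refine (Finset.card_le_card beamsAbove_subset_filter).trans ?_
      rw [Finset.filter_eq_empty_iff.2 (fun x _ => by omega)]
      simp
  · rw [hT.beamsAbove_eq_empty hk hS hD h]
    simp

theorem IsKTriangulation.sum_beamArea_le (hk : 1 ≤ k) (hS : S ⊆ Finset.Ico k (n - k))
    (hT : IsKTriangulation n k T) (hD : stepEdges n k S ⊆ T) (hT' : IsKTriangulation n k T') :
    ∑ h ∈ S, beamArea n T h ≤ ∑ h ∈ S, beamArea n T' h := by
  have hSn : ∀ h ∈ S, h < n := fun h hh => by have := Finset.mem_Ico.1 (hS hh); omega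
  rw [sum_beamArea_eq hSn, sum_beamArea_eq hSn]
  exact Finset.sum_le_sum fun s _ => hT.card_beamsAbove_le hk hS hD hT' s.1 s.2

/-- If the `S`-beams of `T'` bound the minimal area, then `T'` contains `stepEdges n k S`: without
a mirror at such an edge `(u, v)`, the beam passing straight through `(u, v)` would be on the wrong
side of the square to the lower left (if its row is in `S`) or to the upper right of `(u, v)`. -/
theorem IsKTriangulation.stepEdges_subset_of_sum_le (hk : 1 ≤ k) (hS : S ⊆ Finset.Ico k (n - k))
    (hT : IsKTriangulation n k T) (hD : stepEdges n k S ⊆ T) (hT' : IsKTriangulation n k T')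
    (hle : ∑ h ∈ S, beamArea n T' h ≤ ∑ h ∈ S, beamArea n T h) : stepEdges n k S ⊆ T' := by
  have hSn : ∀ h ∈ S, h < n := fun h hh => by have := Finset.mem_Ico.1 (hS hh); omega
  have heq : ∀ a b, a < n → b < n - 1 →
      (beamsAbove T S a b).card = (beamsAbove T' S a b).card := by
    have h1 := le_antisymm (hT.sum_beamArea_le hk hS hD hT') hle
    rw [sum_beamArea_eq hSn, sum_beamArea_eq hSn,
      Finset.sum_eq_sum_iff_of_le fun s _ => hT.card_beamsAbove_le hk hS hD hT' s.1 s.2] at h1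
    intro a b ha hb
    exact h1 (a, b) (by simp [ha, hb])
  rintro ⟨u, v⟩ he
  obtain ⟨⟨huv, hvn⟩, huS, hvS, hcard⟩ := mem_stepEdges.1 he
  simp only at huv hvn huS hvS hcard
  by_contra hm
  have hlong : ¬ (v ≤ u + k ∨ u + n ≤ v + k) := fun h => hm (hT'.mem_of_short huv hvn h)
  have hl' : rayLabel T' false (u + 1) v = rayLabel T' false u v := by
    rw [rayLabel_left_succ, if_neg hm]
  obtain ⟨l, hkl, hln, hl⟩ := (hT'.exists_middle_iff hk (a := u) (y := v) (by omega) hvn).2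
    (by omega)
  have hul : u < l := hT'.lt_of_row hk hkl hln hl hvn
  have hlv : l ≤ v := le_of_rayLabel_eq hl
  by_cases hlS : l ∈ S
  · have hlv' : l < v := lt_of_le_of_ne hlv (ne_of_mem_of_not_mem hlS hvS)
    cases u with
    | zero =>
      rw [hl', rayLabel_left_zero] at hl
      omega
    | succ u =>
      have h1 : k ≤ (Finset.Ioc u (v - 1) \ S).card := by
        have h2 := card_Ico_sdiff_eq S (u + 1) v
        rw [if_pos ⟨huv, huS⟩, hcard] at h2
        rw [← h2]
        refine Finset.card_le_card (Finset.sdiff_subset_sdiff (fun z hz => ?_) (subset_refl S))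
        simp only [Finset.mem_Ioc, Finset.mem_Ico] at hz ⊢
        omega
      have h2 := heq u (v - 1) (by omega) (by omega)
      rw [hT.beamsAbove_eq_empty hk hS hD h1, Finset.card_empty] at h2
      have h3 : l ∈ beamsAbove T' S u (v - 1) :=
        mem_beamsAbove.2 ⟨hlS, by omega, by omega, v, by omega, hl' ▸ hl⟩
      rw [Finset.card_eq_zero.1 h2.symm] at h3
      simp at h3
  · have h1 := card_Ioc_sdiff_eq S u v
    rw [if_pos ⟨huv, hvS⟩, hcard] at h1
    rcases Nat.lt_or_ge v (n - 1) with hv | hv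
    · have h2 := hT.beamsAbove_sdiff_eq hk hS hD h1.le
      have h3 := card_beamsAbove_add (T := T) hS u v
      have h4 := card_beamsAbove_add (T := T') hS u v
      have h5 := hT.card_beamsAbove_eq hT' hk huv
      have h6 := heq u v (by omega) hv
      have h7 : l ∈ beamsAbove T' (Finset.Ico k (n - k) \ S) u v := by
        rw [Finset.eq_of_subset_of_card_le beamsAbove_subset_filter (by rw [← h2]; omega),
          Finset.mem_filter, Finset.mem_sdiff, Finset.mem_Ico]
        exact ⟨⟨by omega, hlS⟩, hul, hlv⟩
      obtain ⟨-, -, -, y, hy, hly⟩ := mem_beamsAbove.1 h7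
      have := rayLabel_left_inj hl hly
      omega
    · -- Here the `k` vertices outside of `S` in `(u, v]` are the last vertices of the polygon.
      have h2 : insert l (Finset.Ico (n - k) n) ⊆ Finset.Ioc u v \ S := by
        intro z hz
        rw [Finset.mem_sdiff, Finset.mem_Ioc]
        rcases Finset.mem_insert.1 hz with rfl | hz
        · exact ⟨⟨hul, hlv⟩, hlS⟩
        · rw [Finset.mem_Ico] at hz
          refine ⟨by omega, fun h => ?_⟩
          have := Finset.mem_Ico.1 (hS h)
          omega
      have h3 := Finset.card_le_card h2
      rw [Finset.card_insert_of_notMem (by rw [Finset.mem_Ico]; omega), Nat.card_Ico, h1] at h3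
      omega

end Separation

/-! ### Edge sets that are not implied by others -/

section SeparatingTriangulations

variable {n k : ℕ} {S J : Finset ℕ}

/-- If `J` contains some `s` close to `v ∉ J`, then a set `S'` that contains `v`, but otherwise only
elements of `J` different from `s`, gives edges which cross an edge of `stepEdges n k J` that ends
in `v`. -/
theorem not_stepEdges_subset_of_close {T : Finset (ℕ × ℕ)} {S' : Finset ℕ} {s v : ℕ}
    (hk : 1 ≤ k) (hT : IsKTriangulation n k T) (hJ : J ⊆ Finset.Ico k (n - k))
    (hS' : S' ⊆ Finset.Ico k (n - k)) (hD : stepEdges n k S' ⊆ T) (hvJ : v ∉ J) (hv : v ∈ S')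
    (hsub : S' ⊆ insert v J) (hsJ : s ∈ J) (hsS' : s ∉ S')
    (h1 : (Finset.Ioo s v \ J).card < k) (h2 : (Finset.Ioo v s \ J).card < k) :
    ¬ stepEdges n k J ⊆ T := by
  intro hDJ
  have hvmid := Finset.mem_Ico.1 (hS' hv)
  have hsv : s ≠ v := ne_of_mem_of_not_mem hsJ hvJ
  have key : ∀ u y, (u, y) ∈ stepEdges n k J → u = v ∨ y = v → u < s → s < y → False := by
    intro u y he huy hus hsy
    obtain ⟨-, -, -, hcard⟩ := mem_stepEdges.1 he
    simp only at hcard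
    refine notMem_of_stepEdges_subset hk hS' hT.crossingFree hD (u := u) (v := y) ?_ ?_ (hDJ he)
    · have h3 : s ∉ Finset.Ioo u y \ J := fun h => (Finset.mem_sdiff.1 h).2 hsJ
      rw [← hcard, ← Finset.card_insert_of_notMem h3]
      refine Finset.card_le_card (Finset.insert_subset ?_ fun z hz => ?_)
      · rw [Finset.mem_sdiff, Finset.mem_Ioo]
        exact ⟨⟨hus, hsy⟩, hsS'⟩
      · rw [Finset.mem_sdiff, Finset.mem_Ioo] at hz ⊢
        refine ⟨hz.1, fun h => ?_⟩
        rcases Finset.mem_insert.1 (hsub h) with rfl | h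
        · omega
        · exact hz.2 h
    · rcases huy with rfl | rfl
      · exact Or.inl hv
      · exact Or.inr hv
  rcases lt_or_gt_of_ne hsv with hlt | hlt
  · obtain ⟨u, he⟩ := exists_stepEdges_right hk hJ hvJ hvmid.1 (by omega)
    refine key u v he (Or.inr rfl) ?_ hlt
    obtain ⟨⟨huv, -⟩, huJ, -, hcard⟩ := mem_stepEdges.1 he
    simp only at huv huJ hcard
    by_contra! hle
    have hne : s ≠ u := ne_of_mem_of_not_mem hsJ huJ
    have h3 : insert u (Finset.Ioo u v \ J) ⊆ Finset.Ioo s v \ J := by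
      refine Finset.insert_subset ?_ (Finset.sdiff_subset_sdiff
        (Finset.Ioo_subset_Ioo hle le_rfl) (subset_refl J))
      rw [Finset.mem_sdiff, Finset.mem_Ioo]
      exact ⟨by omega, huJ⟩
    have h4 := Finset.card_le_card h3
    rw [Finset.card_insert_of_notMem (by simp)] at h4
    omega
  · obtain ⟨y, he⟩ := exists_stepEdges_left hk hJ hvJ (by omega)
    refine key v y he (Or.inl rfl) hlt ?_
    obtain ⟨⟨hvy, -⟩, -, hyJ, hcard⟩ := mem_stepEdges.1 he
    simp only at hvy hyJ hcard
    by_contra! hle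
    have hne : s ≠ y := ne_of_mem_of_not_mem hsJ hyJ
    have h3 : insert y (Finset.Ioo v y \ J) ⊆ Finset.Ioo v s \ J := by
      refine Finset.insert_subset ?_ (Finset.sdiff_subset_sdiff
        (Finset.Ioo_subset_Ioo le_rfl hle) (subset_refl J))
      rw [Finset.mem_sdiff, Finset.mem_Ioo]
      exact ⟨by omega, hyJ⟩
    have h4 := Finset.card_le_card h3
    rw [Finset.card_insert_of_notMem (by simp)] at h4
    omega

theorem exists_adjacent {A B : Finset ℕ} (hA : A.Nonempty) (hB : B.Nonempty) :
    ∃ a ∈ A, ∃ b ∈ B, ∀ x ∈ A ∪ B, x ∉ Finset.Ioo a b ∧ x ∉ Finset.Ioo b a := by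
  obtain ⟨p, hp, hmin⟩ := (A ×ˢ B).exists_min_image (fun p => (p.1 - p.2) + (p.2 - p.1))
    (hA.product hB)
  rw [Finset.mem_product] at hp
  refine ⟨p.1, hp.1, p.2, hp.2, fun x hx => ?_⟩
  rw [Finset.mem_Ioo, Finset.mem_Ioo]
  rcases Finset.mem_union.1 hx with hx | hx
  · have := hmin (x, p.2) (Finset.mem_product.2 ⟨hx, hp.2⟩)
    simp only at this
    omega
  · have := hmin (p.1, x) (Finset.mem_product.2 ⟨hp.1, hx⟩)
    simp only at this
    omega

/-- The set of the positions of the ones of a sequence without a block `1 0 ⋯ 0 1` having at least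
`k` zeros. -/
def HasShortGaps (k : ℕ) (S : Finset ℕ) : Prop :=
  ∀ i ∈ S, ∀ j ∈ S, i + k < j → ∃ l ∈ S, i < l ∧ l < j

theorem isChain_pair_of_subset {A B : Finset ℕ} (h : A ⊆ B) :
    IsChain (· ⊆ ·) ({A, B} : Set (Finset ℕ)) :=
  IsChain.pair h

theorem exists_not_stepEdges_subset_of_ssubset (hk : 1 ≤ k) (hS : S ⊆ Finset.Ico k (n - k))
    (hgaps : HasShortGaps k S) (hJ : J.Nonempty) (hJS : J ⊂ S) :
    ∃ T, IsKTriangulation n k T ∧ stepEdges n k S ⊆ T ∧ ¬ stepEdges n k J ⊆ T := by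
  obtain ⟨s, hs, v, hv, hadj⟩ := exists_adjacent hJ (Finset.sdiff_nonempty.2 hJS.2)
  rw [Finset.union_sdiff_of_subset hJS.1] at hadj
  obtain ⟨hvS, hvJ⟩ := Finset.mem_sdiff.1 hv
  have hsS := hJS.1 hs
  obtain ⟨T, hT, hD⟩ := exists_isKTriangulation_of_isChain (n := n) (k := k)
    (isChain_pair_of_subset (Finset.singleton_subset_iff.2 hvS))
  have hgap : ∀ a ∈ S, ∀ b ∈ S, (∀ x ∈ S, x ∉ Finset.Ioo a b) →
      (Finset.Ioo a b \ J).card < k := by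
    intro a ha b hb hab
    have h1 := Finset.card_le_card (Finset.sdiff_subset (s := Finset.Ioo a b) (t := J))
    rw [Nat.card_Ioo] at h1
    by_contra! h2
    obtain ⟨l, hl, h3⟩ := hgaps a ha b hb (by omega)
    exact hab l hl (Finset.mem_Ioo.2 h3)
  refine ⟨T, hT, hD S (by simp), ?_⟩
  refine not_stepEdges_subset_of_close hk hT (hJS.1.trans hS)
    (Finset.singleton_subset_iff.2 (hS hvS)) (hD {v} (by simp)) hvJ (by simp) (by simp) hs ?_
    (hgap s hsS v hvS fun x hx => (hadj x hx).1) (hgap v hvS s hsS fun x hx => (hadj x hx).2)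
  rw [Finset.mem_singleton]
  exact ne_of_mem_of_not_mem hs hvJ

theorem exists_not_stepEdges_subset_of_ssuperset (hk : 1 ≤ k) (hSJ : S ⊂ J)
    (hJ : J ⊂ Finset.Ico k (n - k)) :
    ∃ T, IsKTriangulation n k T ∧ stepEdges n k S ⊆ T ∧ ¬ stepEdges n k J ⊆ T := by
  obtain ⟨s, hs, v, hv, hadj⟩ := exists_adjacent (Finset.sdiff_nonempty.2 hSJ.2)
    (Finset.sdiff_nonempty.2 hJ.2)
  obtain ⟨hsJ, hsS⟩ := Finset.mem_sdiff.1 hs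
  obtain ⟨hvmid, hvJ⟩ := Finset.mem_sdiff.1 hv
  have hsmid := hJ.1 hsJ
  rw [Finset.mem_Ico] at hsmid hvmid
  obtain ⟨T, hT, hD⟩ := exists_isKTriangulation_of_isChain (n := n) (k := k)
    (isChain_pair_of_subset (Finset.subset_insert v S))
  have hgap : ∀ a b, k ≤ a → b < n - k → (∀ x ∈ Finset.Ico k (n - k) \ J, x ∉ Finset.Ioo a b) →
      (Finset.Ioo a b \ J).card < k := by
    intro a b ha hb hab
    rw [Finset.sdiff_eq_empty_iff_subset.2, Finset.card_empty]
    · exact hk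
    · intro x hx
      by_contra hxJ
      refine hab x (Finset.mem_sdiff.2 ⟨?_, hxJ⟩) hx
      rw [Finset.mem_Ioo] at hx
      rw [Finset.mem_Ico]
      omega
  refine ⟨T, hT, hD S (by simp), ?_⟩
  refine not_stepEdges_subset_of_close (S' := insert v S) hk hT hJ.1
    (Finset.insert_subset (Finset.mem_Ico.2 hvmid) (hSJ.1.trans hJ.1)) (hD _ (by simp)) hvJ
    (by simp) (Finset.insert_subset_insert _ hSJ.1) hsJ ?_
    (hgap s v hsmid.1 hvmid.2 fun x hx => (hadj x (Finset.mem_union_right _ hx)).1)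
    (hgap v s hvmid.1 hsmid.2 fun x hx => (hadj x (Finset.mem_union_right _ hx)).2)
  rw [Finset.mem_insert, not_or]
  exact ⟨ne_of_mem_of_not_mem hsJ hvJ, hsS⟩

/-- A non-empty set has an initial part with short gaps, separated from the rest by a long gap. An
edge of the polygon cannot pass over both parts without passing over too many vertices in this gap,
so the edges for each part are edges for the whole set or belong to all `k`-triangulations. -/
theorem exists_hasShortGaps_subset (hk : 1 ≤ k) (hS : S.Nonempty) :
    ∃ B ⊆ S, B.Nonempty ∧ HasShortGaps k B ∧
      ∀ T, IsKTriangulation n k T → stepEdges n k S ⊆ T →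
        stepEdges n k B ⊆ T ∧ stepEdges n k (S \ B) ⊆ T := by
  set E := S.filter fun i => ∀ s ∈ S, s ≤ i ∨ i + k < s with hE
  have hEne : E.Nonempty :=
    ⟨S.max' hS, Finset.mem_filter.2 ⟨S.max'_mem hS, fun s hs => Or.inl (S.le_max' s hs)⟩⟩
  obtain ⟨i, hiE, hmin⟩ := E.exists_min_image id hEne
  obtain ⟨hiS, hi⟩ := Finset.mem_filter.1 hiE
  have hmemB : ∀ x, x ∈ S.filter (· ≤ i) ↔ x ∈ S ∧ x ≤ i := fun x => Finset.mem_filter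
  have hmemB' : ∀ x, x ∈ S \ S.filter (· ≤ i) ↔ x ∈ S ∧ i + k < x := by
    intro x
    rw [Finset.mem_sdiff, hmemB]
    constructor
    · rintro ⟨h1, h2⟩
      rcases hi x h1 with h | h
      · exact absurd ⟨h1, h⟩ h2
      · exact ⟨h1, h⟩
    · rintro ⟨h1, h2⟩
      exact ⟨h1, fun h => by omega⟩
  -- An edge of `stepEdges n k A` is short or passes over an element of `A`.
  have hlong : ∀ A : Finset ℕ, ∀ u v, (u, v) ∈ stepEdges n k A →
      v ≤ u + k ∨ ∃ b ∈ A, u < b ∧ b < v := by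
    intro A u v he
    obtain ⟨-, -, -, hcard⟩ := mem_stepEdges.1 he
    by_contra! hcon
    have h1 : Finset.Ioo u v \ A = Finset.Ioo u v :=
      Finset.sdiff_eq_self_iff_disjoint.2 (Finset.disjoint_left.2 fun b hb hbA => by
        rw [Finset.mem_Ioo] at hb
        have := hcon.2 b hbA hb.1
        omega)
    simp only [h1, Nat.card_Ioo] at hcard
    omega
  have hcongr : ∀ A : Finset ℕ, ∀ u v, (u, v) ∈ stepEdges n k A →
      (∀ x, u ≤ x → x ≤ v → (x ∈ S ↔ x ∈ A)) → (u, v) ∈ stepEdges n k S := by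
    intro A u v he hA
    obtain ⟨⟨huv, hvn⟩, hu, hv, hcard⟩ := mem_stepEdges.1 he
    simp only at huv hvn hu hv hcard
    refine mem_stepEdges.2 ⟨⟨huv, hvn⟩, by rwa [hA u le_rfl huv.le],
      by rwa [hA v huv.le le_rfl], ?_⟩
    rw [← hcard]
    congr 2
    ext x
    simp only [Finset.mem_sdiff, Finset.mem_Ioo]
    refine and_congr_right fun hx => ?_
    rw [hA x (by omega) (by omega)]
  refine ⟨S.filter (· ≤ i), Finset.filter_subset _ _, ⟨i, (hmemB i).2 ⟨hiS, le_rfl⟩⟩, ?_, ?_⟩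
  · intro a ha b hb hab
    by_contra! hcon
    rw [hmemB] at ha hb
    have haE : a ∈ E := by
      refine Finset.mem_filter.2 ⟨ha.1, fun s hs => ?_⟩
      by_contra! hcon2
      have := hcon s ((hmemB s).2 ⟨hs, by omega⟩) (by omega)
      omega
    have := hmin a haE
    simp only [id] at this
    omega
  · intro T hT hD
    constructor
    · rintro ⟨u, v⟩ he
      have h0 := mem_stepEdges.1 he
      simp only at h0
      rcases hlong _ u v he with h | ⟨b, hb, hub, hbv⟩
      · exact hT.mem_of_short h0.1.1 h0.1.2 (Or.inl h)
      rw [hmemB] at hb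
      have hv : v ≤ i + k := by
        have h1 := Finset.card_le_card (s := Finset.Ioo i v)
          (t := Finset.Ioo u v \ S.filter (· ≤ i)) (fun x hx => by
            rw [Finset.mem_sdiff, hmemB]
            rw [Finset.mem_Ioo] at hx ⊢
            omega)
        rw [Nat.card_Ioo] at h1
        omega
      refine hD (hcongr _ u v he fun x _ hxv => ?_)
      rw [hmemB]
      refine ⟨fun hx => ⟨hx, ?_⟩, fun hx => hx.1⟩
      rcases hi x hx with h | h <;> omega
    · rintro ⟨u, v⟩ he
      have h0 := mem_stepEdges.1 he
      simp only at h0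
      rcases hlong _ u v he with h | ⟨b, hb, hub, hbv⟩
      · exact hT.mem_of_short h0.1.1 h0.1.2 (Or.inl h)
      rw [hmemB'] at hb
      have hu : i < u := by
        by_contra! hui
        have h1 := Finset.card_le_card (s := Finset.Ioc i (i + k))
          (t := Finset.Ioo u v \ (S \ S.filter (· ≤ i))) (fun x hx => by
            rw [Finset.mem_sdiff, hmemB']
            rw [Finset.mem_Ioo]
            rw [Finset.mem_Ioc] at hx
            omega)
        rw [Nat.card_Ioc] at h1
        omega
      refine hD (hcongr _ u v he fun x hux _ => ?_)
      rw [hmemB']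
      refine ⟨fun hx => ⟨hx, ?_⟩, fun hx => hx.1⟩
      rcases hi x hx with h | h <;> omega

/-- The edges for the set of all middle vertices belong to every `k`-triangulation. -/
theorem IsKTriangulation.stepEdges_middle_subset {T : Finset (ℕ × ℕ)}
    (hT : IsKTriangulation n k T) : stepEdges n k (Finset.Ico k (n - k)) ⊆ T := by
  rintro ⟨u, v⟩ he
  obtain ⟨⟨huv, hvn⟩, hu, hv, hcard⟩ := mem_stepEdges.1 he
  simp only [Finset.mem_Ico] at huv hvn hu hv hcard
  refine hT.mem_of_short huv hvn ?_
  by_contra! hcon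
  have h1 : Finset.Ico k (n - k) ⊆ Finset.Ioo u v := by
    intro x hx
    rw [Finset.mem_Ico] at hx
    rw [Finset.mem_Ioo]
    omega
  rw [Finset.card_sdiff_of_subset h1, Nat.card_Ioo, Nat.card_Ico] at hcard
  omega

end SeparatingTriangulations

/-! ### 0/1-sequences and sets of rows -/

section Rows

variable {n k : ℕ}

/-- The rows of the beams with index in `I`. -/
def beamRows (k : ℕ) {q : ℕ} (I : Finset (Fin q)) : Finset ℕ :=
  I.map ⟨fun i : Fin q => k + (i : ℕ), fun i j h => Fin.ext (by simpa using h)⟩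

theorem mem_beamRows {q : ℕ} {I : Finset (Fin q)} {h : ℕ} :
    h ∈ beamRows k I ↔ ∃ i ∈ I, k + (i : ℕ) = h := Finset.mem_map

theorem add_mem_beamRows {q : ℕ} {I : Finset (Fin q)} {i : Fin q} :
    k + (i : ℕ) ∈ beamRows k I ↔ i ∈ I := by
  rw [mem_beamRows]
  constructor
  · rintro ⟨j, hj, hji⟩
    rwa [← show j = i from Fin.ext (by omega)]
  · exact fun h => ⟨i, h, rfl⟩

theorem beamRows_subset_middle (I : Finset (Fin (n - 2 * k))) :
    beamRows k I ⊆ Finset.Ico k (n - k) := by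
  intro h hh
  obtain ⟨i, -, rfl⟩ := mem_beamRows.1 hh
  rw [Finset.mem_Ico]
  omega

theorem beamRows_univ : beamRows k (Finset.univ : Finset (Fin (n - 2 * k))) =
    Finset.Ico k (n - k) := by
  refine (beamRows_subset_middle _).antisymm fun h hh => ?_
  rw [Finset.mem_Ico] at hh
  exact mem_beamRows.2 ⟨⟨h - k, by omega⟩, Finset.mem_univ _, by simp only; omega⟩

theorem beamRows_subset_iff {q : ℕ} {I J : Finset (Fin q)} :
    beamRows k I ⊆ beamRows k J ↔ I ⊆ J := Finset.map_subset_map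

theorem beamRows_ssubset_iff {q : ℕ} {I J : Finset (Fin q)} :
    beamRows k I ⊂ beamRows k J ↔ I ⊂ J := Finset.map_ssubset_map

theorem exists_beamRows_eq {S : Finset ℕ} (hS : S ⊆ Finset.Ico k (n - k)) :
    ∃ I : Finset (Fin (n - 2 * k)), beamRows k I = S := by
  refine ⟨Finset.univ.filter fun i => k + (i : ℕ) ∈ S, ?_⟩
  ext h
  rw [mem_beamRows]
  constructor
  · rintro ⟨i, hi, rfl⟩
    exact (Finset.mem_filter.1 hi).2
  · intro hh
    have := Finset.mem_Ico.1 (hS hh)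
    have h1 : k + (h - k) = h := by omega
    exact ⟨⟨h - k, by omega⟩, by simpa [h1] using hh, h1⟩

/-- The indices of the ones of a 0/1-sequence. -/
def oneIndices {q : ℕ} (σ : Fin q → Bool) : Finset (Fin q) := Finset.univ.filter fun i => σ i = true

theorem mem_oneIndices {q : ℕ} {σ : Fin q → Bool} {i : Fin q} : i ∈ oneIndices σ ↔ σ i = true := by
  simp [oneIndices]

theorem isValidSeq_iff {q : ℕ} (σ : Fin q → Bool) : IsValidSeq k σ ↔
    (oneIndices σ).Nonempty ∧ oneIndices σ ≠ Finset.univ ∧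
      HasShortGaps k (beamRows k (oneIndices σ)) := by
  unfold IsValidSeq
  refine and_congr ?_ (and_congr ?_ ?_)
  · simp [Finset.Nonempty, mem_oneIndices]
  · simp [Finset.ext_iff, mem_oneIndices]
  · constructor
    · intro h a ha b hb hab
      obtain ⟨i, hi, rfl⟩ := mem_beamRows.1 ha
      obtain ⟨j, hj, rfl⟩ := mem_beamRows.1 hb
      by_contra! hcon
      refine h ⟨i, j, by omega, mem_oneIndices.1 hi, mem_oneIndices.1 hj, fun l hil hlj => ?_⟩
      by_contra hl
      have := hcon (k + l) (add_mem_beamRows.2 (mem_oneIndices.2 (by simpa using hl)))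
        (by omega)
      omega
    · rintro h ⟨i, j, hij, hi, hj, hl⟩
      obtain ⟨m, hm, h1, h2⟩ := h _ (add_mem_beamRows.2 (mem_oneIndices.2 hi)) _
        (add_mem_beamRows.2 (mem_oneIndices.2 hj)) (by omega)
      obtain ⟨l, hlI, rfl⟩ := mem_beamRows.1 hm
      have := hl l (by omega) (by omega)
      rw [mem_oneIndices.1 hlI] at this
      simp at this

theorem isZeroPos_iff (σ : Fin (n - 2 * k) → Bool) (p : ℕ) :
    IsZeroPos n k σ p ↔ p < n ∧ p ∉ beamRows k (oneIndices σ) := by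
  unfold IsZeroPos
  refine and_congr_right fun _ => ?_
  rw [mem_beamRows]
  constructor
  · rintro h ⟨i, hi, hip⟩
    have := h i hip
    rw [mem_oneIndices.1 hi] at this
    simp at this
  · intro h i hip
    by_contra hi
    exact h ⟨i, mem_oneIndices.2 (by simpa using hi), hip⟩

theorem zeroPos_eq (σ : Fin (n - 2 * k) → Bool) {i : ℕ}
    (hi : Nat.nth (· ∉ beamRows k (oneIndices σ)) i < n) :
    zeroPos n k σ i = Nat.nth (· ∉ beamRows k (oneIndices σ)) i := by
  classical
  set S := beamRows k (oneIndices σ) with hS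
  have hp : IsZeroPos n k σ (Nat.nth (· ∉ S) i) :=
    (isZeroPos_iff σ _).2 ⟨hi, Nat.nth_mem_of_infinite (infinite_notMem S) i⟩
  have hcount : Nat.count (IsZeroPos n k σ) (Nat.nth (· ∉ S) i) = i := by
    conv_rhs => rw [← Nat.count_nth_of_infinite (infinite_notMem S) i]
    rw [Nat.count_eq_card_filter_range, Nat.count_eq_card_filter_range]
    congr 1
    refine Finset.filter_congr fun x hx => ?_
    rw [Finset.mem_range] at hx
    rw [isZeroPos_iff]
    exact and_iff_right (hx.trans hi)
  have := Nat.nth_count hp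
  rwa [hcount] at this

theorem count_notMem_beamRows (hn : 2 * k + 1 ≤ n) (σ : Fin (n - 2 * k) → Bool) :
    Nat.count (· ∉ beamRows k (oneIndices σ)) n = numZeros σ + 2 * k := by
  set S := beamRows k (oneIndices σ) with hS
  have h1 : (Finset.range n).filter (· ∉ S) = Finset.range n \ S := by
    ext x
    simp
  have h2 : S ⊆ Finset.range n := fun x hx => by
    have := Finset.mem_Ico.1 (beamRows_subset_middle _ hx)
    rw [Finset.mem_range]
    omega
  have h3 : S.card = (oneIndices σ).card := Finset.card_map _
  have h4 : (oneIndices σ).card + numZeros σ = n - 2 * k := by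
    have := Finset.card_filter_add_card_filter_not (s := (Finset.univ : Finset (Fin (n - 2 * k))))
      (fun i => σ i = true)
    simpa [oneIndices, numZeros] using this
  rw [Nat.count_eq_card_filter_range, h1, Finset.card_sdiff_of_subset h2, Finset.card_range, h3]
  omega

theorem edgeSetD_eq_stepEdges (hk : 1 ≤ k) (hn : 2 * k + 1 ≤ n) (σ : Fin (n - 2 * k) → Bool) :
    edgeSetD n k σ = stepEdges n k (beamRows k (oneIndices σ)) := by
  have hcount := count_notMem_beamRows hn σ
  set S := beamRows k (oneIndices σ) with hS
  have hmono := Nat.nth_strictMono (infinite_notMem S)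
  have hlt : ∀ i, Nat.nth (· ∉ S) (i + k) < n ↔ i < numZeros σ + k := by
    intro i
    rw [← not_le, ← Nat.count_le_iff_le_nth (infinite_notMem S), hcount]
    omega
  ext e
  rw [mem_stepEdges_iff_exists_nth hk, edgeSetD, Finset.mem_image]
  constructor
  · rintro ⟨i, hi, rfl⟩
    rw [Finset.mem_range, ← hlt] at hi
    have hi' : Nat.nth (· ∉ S) i < n := lt_trans (hmono (by omega)) hi
    rw [zeroPos_eq σ hi, zeroPos_eq σ hi']
    exact ⟨i, rfl, hi⟩
  · rintro ⟨i, rfl, hi⟩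
    have hi' : Nat.nth (· ∉ S) i < n := lt_trans (hmono (by omega)) hi
    exact ⟨i, Finset.mem_range.2 ((hlt i).1 hi), by rw [zeroPos_eq σ hi, zeroPos_eq σ hi']⟩

end Rows

/-! ### Superlevel sets of a linear form -/

section Levels

variable {ι : Type*} [Fintype ι]

/-- Summation by parts: if the sum of `d` is zero and its sums over the superlevel sets of `w` are
non-negative, then so is `∑ i, w i * d i`. -/
theorem sum_mul_nonneg_of_levels (w d : ι → ℝ) (h0 : ∑ i, d i = 0)
    (h : ∀ t, 0 ≤ ∑ i with t ≤ w i, d i) : 0 ≤ ∑ i, w i * d i := by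
  classical
  induction hm : (Finset.univ.image w).card using Nat.strong_induction_on generalizing w with
  | _ m ih =>
    subst hm
    by_cases hconst : ∃ c, ∀ i, w i = c
    · obtain ⟨c, hc⟩ := hconst
      simp only [hc, ← Finset.mul_sum, h0, mul_zero, le_refl]
    have hne : (Finset.univ : Finset ι).Nonempty := by
      by_contra hemp
      rw [Finset.not_nonempty_iff_eq_empty] at hemp
      refine hconst ⟨0, fun i => ?_⟩
      have := Finset.mem_univ i
      simp [hemp] at this
    obtain ⟨i₀, -, hi₀⟩ := Finset.univ.exists_max_image w hne
    have hne' : (Finset.univ.filter fun i => w i ≠ w i₀).Nonempty := by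
      by_contra hemp
      rw [Finset.not_nonempty_iff_eq_empty, Finset.filter_eq_empty_iff] at hemp
      exact hconst ⟨w i₀, fun i => by simpa using hemp (Finset.mem_univ i)⟩
    obtain ⟨i₁, hi₁, hmax⟩ := Finset.exists_max_image _ w hne'
    have hlt : w i₁ < w i₀ :=
      lt_of_le_of_ne (hi₀ i₁ (Finset.mem_univ _)) (Finset.mem_filter.1 hi₁).2
    -- Lower the largest value of `w` to the second largest one.
    have key := ih _ ?_ (fun i => min (w i) (w i₁)) ?_ rfl
    · have hsplit : ∑ i, w i * d i = ∑ i, min (w i) (w i₁) * d i +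
          (w i₀ - w i₁) * ∑ i with w i₀ ≤ w i, d i := by
        rw [Finset.mul_sum, Finset.sum_filter, ← Finset.sum_add_distrib]
        refine Finset.sum_congr rfl fun i _ => ?_
        by_cases hi : w i = w i₀
        · rw [if_pos hi.ge, hi, min_eq_right hlt.le]
          ring
        · have h1 := hi₀ i (Finset.mem_univ i)
          rw [if_neg (fun h' => hi (le_antisymm h1 h')),
            min_eq_left (hmax i (Finset.mem_filter.2 ⟨Finset.mem_univ _, hi⟩)), add_zero]
      rw [hsplit]
      have := mul_nonneg (sub_nonneg.2 hlt.le) (h (w i₀))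
      linarith
    · refine Finset.card_lt_card (Finset.ssubset_iff_subset_ne.2 ⟨?_, fun heq => ?_⟩)
      · intro x hx
        obtain ⟨i, -, rfl⟩ := Finset.mem_image.1 hx
        rcases min_choice (w i) (w i₁) with h' | h' <;> rw [h'] <;>
          exact Finset.mem_image_of_mem w (Finset.mem_univ _)
      · have h1 := Finset.mem_image_of_mem w (Finset.mem_univ i₀)
        rw [← heq] at h1
        obtain ⟨i, -, hi⟩ := Finset.mem_image.1 h1
        have := min_le_right (w i) (w i₁)
        linarith
    · intro t
      simp only [le_min_iff]
      by_cases ht : t ≤ w i₁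
      · simpa [ht] using h t
      · simp [ht]

/-- In the situation of `sum_mul_nonneg_of_levels`, if `∑ i, w i * d i` is zero then so are the sums
of `d` over all superlevel sets of `w`. -/
theorem sum_level_eq_zero (w d : ι → ℝ) (h0 : ∑ i, d i = 0)
    (h : ∀ t, 0 ≤ ∑ i with t ≤ w i, d i) (hle : ∑ i, w i * d i ≤ 0) (t : ℝ) :
    ∑ i with t ≤ w i, d i = 0 := by
  classical
  rcases (Finset.univ.filter fun i => t ≤ w i).eq_empty_or_nonempty with hemp | hne
  · rw [hemp, Finset.sum_empty]
  rcases (Finset.univ.filter fun i => ¬ t ≤ w i).eq_empty_or_nonempty with hemp | hne'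
  · rw [Finset.filter_eq_empty_iff] at hemp
    rw [Finset.filter_true_of_mem fun i hi => not_not.1 (hemp hi), h0]
  obtain ⟨i₀, hi₀, hmin⟩ := Finset.exists_min_image _ w hne
  obtain ⟨i₁, hi₁, hmax⟩ := Finset.exists_max_image _ w hne'
  simp only [Finset.mem_filter, Finset.mem_univ, true_and, not_le] at hi₀ hi₁ hmin hmax
  have hlt : w i₁ < w i₀ := hi₁.trans_le hi₀
  -- Lower the values of `w` on the superlevel set until they reach the largest value outside.
  have key := sum_mul_nonneg_of_levels (fun i => w i - if t ≤ w i then w i₀ - w i₁ else 0) d h0 ?_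
  · have hsplit : ∑ i, (w i - if t ≤ w i then w i₀ - w i₁ else 0) * d i =
        ∑ i, w i * d i - (w i₀ - w i₁) * ∑ i with t ≤ w i, d i := by
      rw [Finset.mul_sum, Finset.sum_filter, ← Finset.sum_sub_distrib]
      refine Finset.sum_congr rfl fun i _ => ?_
      split_ifs <;> ring
    rw [hsplit] at key
    have h1 := h t
    have h2 : 0 < w i₀ - w i₁ := sub_pos.2 hlt
    nlinarith
  · intro s
    rcases le_or_gt s (w i₁) with hs | hs
    · convert h s using 2
      ext i
      simp only [Finset.mem_filter, Finset.mem_univ, true_and]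
      split_ifs with hi
      · have := hmin i hi
        constructor <;> intro <;> linarith
      · rw [sub_zero]
    · convert h (s + (w i₀ - w i₁)) using 2
      ext i
      simp only [Finset.mem_filter, Finset.mem_univ, true_and]
      split_ifs with hi
      · constructor <;> intro <;> linarith
      · have := hmax i (not_le.1 hi)
        constructor <;> intro <;> linarith

end Levels

/-! ### Linear forms on the beam polytope -/

section Polytope

variable {n k : ℕ} {T T' : Finset (ℕ × ℕ)} {I J : Finset (Fin (n - 2 * k))}

theorem seqVector_dotProduct {q : ℕ} (σ : Fin q → Bool) (x : Fin q → ℝ) :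
    seqVector σ ⬝ᵥ x = ∑ i ∈ oneIndices σ, x i := by
  simp [dotProduct, seqVector, oneIndices, Finset.sum_filter]

theorem sum_beamVector (T : Finset (ℕ × ℕ)) (I : Finset (Fin (n - 2 * k))) :
    ∑ i ∈ I, beamVector n k T i = ((∑ h ∈ beamRows k I, beamArea n T h : ℕ) : ℝ) := by
  rw [beamRows, Finset.sum_map, Nat.cast_sum]
  rfl

theorem beamVector_mem (hT : IsKTriangulation n k T) : beamVector n k T ∈ beamPolytope n k :=
  subset_convexHull ℝ _ ⟨T, hT, rfl⟩

/-- A linear inequality for the beam vectors holds on the beam polytope. -/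
theorem le_dotProduct_of_mem_beamPolytope {w : Fin (n - 2 * k) → ℝ} {c : ℝ}
    (h : ∀ T, IsKTriangulation n k T → c ≤ w ⬝ᵥ beamVector n k T) {x : Fin (n - 2 * k) → ℝ}
    (hx : x ∈ beamPolytope n k) : c ≤ w ⬝ᵥ x := by
  have hconv : Convex ℝ {x : Fin (n - 2 * k) → ℝ | c ≤ w ⬝ᵥ x} :=
    convex_halfSpace_ge ⟨dotProduct_add w, fun r x => dotProduct_smul r w x⟩ c
  refine convexHull_min ?_ hconv hx
  rintro _ ⟨T, hT, rfl⟩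
  exact h T hT

theorem sum_eq_indicator_dotProduct {q : ℕ} (I : Finset (Fin q)) (x : Fin q → ℝ) :
    ∑ i ∈ I, x i = (fun i => if i ∈ I then (1 : ℝ) else 0) ⬝ᵥ x := by
  simp [dotProduct]

theorem sum_beamVector_le_of_mem (hk : 1 ≤ k) (hT : IsKTriangulation n k T)
    (hD : stepEdges n k (beamRows k I) ⊆ T) {x : Fin (n - 2 * k) → ℝ}
    (hx : x ∈ beamPolytope n k) : ∑ i ∈ I, beamVector n k T i ≤ ∑ i ∈ I, x i := by
  rw [sum_eq_indicator_dotProduct I x]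
  refine le_dotProduct_of_mem_beamPolytope (fun T' hT' => ?_) hx
  rw [← sum_eq_indicator_dotProduct, sum_beamVector, sum_beamVector, Nat.cast_le]
  exact hT.sum_beamArea_le hk (beamRows_subset_middle I) hD hT'

theorem sum_beamVector_eq_iff (hk : 1 ≤ k) (hT : IsKTriangulation n k T)
    (hD : stepEdges n k (beamRows k I) ⊆ T) (hT' : IsKTriangulation n k T') :
    ∑ i ∈ I, beamVector n k T' i = ∑ i ∈ I, beamVector n k T i ↔
      stepEdges n k (beamRows k I) ⊆ T' := by
  constructor
  · intro h
    rw [sum_beamVector, sum_beamVector, Nat.cast_inj] at h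
    exact hT.stepEdges_subset_of_sum_le hk (beamRows_subset_middle I) hD hT' h.le
  · intro hD'
    exact le_antisymm (sum_beamVector_le_of_mem hk hT' hD' (beamVector_mem hT))
      (sum_beamVector_le_of_mem hk hT hD (beamVector_mem hT'))

/-- The beam polytope lies in a hyperplane on which the sum of the coordinates is constant. -/
theorem sum_eq_of_mem_beamPolytope (hk : 1 ≤ k) {x y : Fin (n - 2 * k) → ℝ}
    (hx : x ∈ beamPolytope n k) (hy : y ∈ beamPolytope n k) : ∑ i, x i = ∑ i, y i := by
  obtain ⟨T, hT, -⟩ := exists_isKTriangulation_of_isChain (n := n) (k := k)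
    (𝒮 := ∅) (by simp)
  have hall : ∀ T', IsKTriangulation n k T' →
      stepEdges n k (beamRows k (Finset.univ : Finset (Fin (n - 2 * k)))) ⊆ T' := by
    intro T' hT'
    rw [beamRows_univ]
    exact hT'.stepEdges_middle_subset
  have key : ∀ x ∈ beamPolytope n k, ∑ i, x i = ∑ i, beamVector n k T i := by
    intro x hx
    refine le_antisymm ?_ (sum_beamVector_le_of_mem hk hT (hall T hT) hx)
    have h1 := le_dotProduct_of_mem_beamPolytope (w := fun _ => -1)
      (c := -∑ i, beamVector n k T i) (fun T' hT' => by
        have := (sum_beamVector_eq_iff hk hT (hall T hT) hT').2 (hall T' hT')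
        simp [dotProduct, this]) hx
    simp [dotProduct] at h1
    exact h1
  rw [key x hx, key y hy]

theorem mem_face_iff (hk : 1 ≤ k) {σ : Fin (n - 2 * k) → Bool} (hT : IsKTriangulation n k T)
    (hD : stepEdges n k (beamRows k (oneIndices σ)) ⊆ T) {x : Fin (n - 2 * k) → ℝ} :
    x ∈ faceOfNormal (beamPolytope n k) (seqVector σ) ↔ x ∈ beamPolytope n k ∧
      ∑ i ∈ oneIndices σ, x i = ∑ i ∈ oneIndices σ, beamVector n k T i := by
  simp only [faceOfNormal, Set.mem_ofPred_eq, seqVector_dotProduct]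
  refine and_congr_right fun hx => ⟨fun h => ?_, fun h y hy => ?_⟩
  · exact le_antisymm (h _ (beamVector_mem hT)) (sum_beamVector_le_of_mem hk hT hD hx)
  · rw [h]
    exact sum_beamVector_le_of_mem hk hT hD hy

theorem beamVector_mem_face_iff (hk : 1 ≤ k) {σ : Fin (n - 2 * k) → Bool}
    (hT : IsKTriangulation n k T) :
    beamVector n k T ∈ faceOfNormal (beamPolytope n k) (seqVector σ) ↔
      stepEdges n k (beamRows k (oneIndices σ)) ⊆ T := by
  obtain ⟨T₀, hT₀, hD⟩ := exists_isKTriangulation_of_isChain (n := n) (k := k)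
    (Set.subsingleton_singleton (a := beamRows k (oneIndices σ))).isChain
  rw [mem_face_iff hk hT₀ (hD _ rfl), sum_beamVector_eq_iff hk hT₀ (hD _ rfl) hT]
  exact and_iff_right (beamVector_mem hT)

/-- A linear form `w` that is constant on the beam vectors of the `k`-triangulations containing the
edges for `I` has equal coefficients at the indices in `I`, and equal coefficients at the others; by
symmetry it suffices to state an inequality. Otherwise, after adding a large multiple of the
indicator of `I`, a superlevel set `J` of the coefficients lies strictly between `∅` and `I` or
between `I` and the set of all indices. But all `k`-triangulations containing the edges for `I`
would then have to contain the edges for `J`. -/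
theorem eq_of_constant_on_face (hk : 1 ≤ k) (hI : HasShortGaps k (beamRows k I))
    {w : Fin (n - 2 * k) → ℝ}
    (hw : ∀ T T', IsKTriangulation n k T → IsKTriangulation n k T' →
      stepEdges n k (beamRows k I) ⊆ T → stepEdges n k (beamRows k I) ⊆ T' →
      w ⬝ᵥ beamVector n k T = w ⬝ᵥ beamVector n k T') {i j : Fin (n - 2 * k)}
    (hij : i ∈ I ↔ j ∈ I) : w i ≤ w j := by
  by_contra! hlt
  set M : ℝ := 1 + 2 * ∑ l, |w l| with hM
  have hspread : ∀ a b, w a < w b + M := by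
    intro a b
    have h1 := Finset.single_le_sum (f := fun l => |w l|) (fun l _ => abs_nonneg _)
      (Finset.mem_univ a)
    have h2 := Finset.single_le_sum (f := fun l => |w l|) (fun l _ => abs_nonneg _)
      (Finset.mem_univ b)
    have h3 := le_abs_self (w a)
    have h4 := neg_abs_le (w b)
    linarith
  set w' : Fin (n - 2 * k) → ℝ := fun l => w l + if l ∈ I then M else 0 with hw'
  set L : ℝ → Finset (Fin (n - 2 * k)) := fun t => Finset.univ.filter fun l => t ≤ w' l with hL
  have hLmono : ∀ s t, s ≤ t → L t ⊆ L s := fun s t hst l hl => by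
    simp only [hL, Finset.mem_filter, Finset.mem_univ, true_and] at hl ⊢
    exact hst.trans hl
  have hLI : ∀ t, L t ⊆ I ∨ I ⊆ L t := by
    intro t
    by_contra! hcon
    obtain ⟨a, ha, haI⟩ := Finset.not_subset.1 hcon.1
    obtain ⟨b, hbI, hb⟩ := Finset.not_subset.1 hcon.2
    simp only [hL, hw', Finset.mem_filter, Finset.mem_univ, true_and, haI, hbI, if_true, if_false,
      not_le] at ha hb
    have := hspread a b
    linarith
  obtain ⟨T₀, hT₀, hD₀⟩ := exists_isKTriangulation_of_isChain (n := n) (k := k)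
    (𝒮 := insert (beamRows k I) (Set.range fun t => beamRows k (L t))) (by
      refine IsChain.insert ?_ ?_
      · rintro _ ⟨s, rfl⟩ _ ⟨t, rfl⟩ _
        rcases le_total s t with h | h
        · exact Or.inr (beamRows_subset_iff.2 (hLmono s t h))
        · exact Or.inl (beamRows_subset_iff.2 (hLmono t s h))
      · rintro _ ⟨t, rfl⟩ _
        exact (hLI t).symm.imp beamRows_subset_iff.2 beamRows_subset_iff.2)
  have hDI := hD₀ _ (Set.mem_insert _ _)
  have hDL : ∀ t, stepEdges n k (beamRows k (L t)) ⊆ T₀ := fun t =>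
    hD₀ _ (Set.mem_insert_of_mem _ ⟨t, rfl⟩)
  have hall : ∀ t T, IsKTriangulation n k T → stepEdges n k (beamRows k I) ⊆ T →
      stepEdges n k (beamRows k (L t)) ⊆ T := by
    intro t T hT hD
    rw [← sum_beamVector_eq_iff hk hT₀ (hDL t) hT, ← sub_eq_zero, ← Finset.sum_sub_distrib]
    refine sum_level_eq_zero w' (fun l => beamVector n k T l - beamVector n k T₀ l) ?_ ?_ ?_ t
    · rw [Finset.sum_sub_distrib, sub_eq_zero]
      exact sum_eq_of_mem_beamPolytope hk (beamVector_mem hT) (beamVector_mem hT₀)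
    · intro t
      rw [Finset.sum_sub_distrib, sub_nonneg]
      exact sum_beamVector_le_of_mem hk hT₀ (hDL t) (beamVector_mem hT)
    · have h1 := hw T T₀ hT hT₀ hD hDI
      have h2 := (sum_beamVector_eq_iff hk hT₀ hDI hT).2 hD
      have h3 : ∑ l, w' l * (beamVector n k T l - beamVector n k T₀ l) =
          (w ⬝ᵥ beamVector n k T - w ⬝ᵥ beamVector n k T₀) +
            M * (∑ l ∈ I, beamVector n k T l - ∑ l ∈ I, beamVector n k T₀ l) := by
        have h4 : ∀ f : Fin (n - 2 * k) → ℝ, ∑ l ∈ I, f l = ∑ l, if l ∈ I then f l else 0 :=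
          fun f => by simp
        rw [← Finset.sum_sub_distrib, h4, Finset.mul_sum, dotProduct, dotProduct,
          ← Finset.sum_sub_distrib, ← Finset.sum_add_distrib]
        refine Finset.sum_congr rfl fun l _ => ?_
        simp only [hw']
        split_ifs <;> ring
      rw [h3, h1, h2, sub_self, sub_self, mul_zero, add_zero]
  have hi : i ∈ L (w' i) := by simp [hL]
  have hj : j ∉ L (w' i) := by
    simp only [hL, hw', Finset.mem_filter, Finset.mem_univ, true_and, not_le, hij]
    linarith
  obtain ⟨T, hT, hD, hnot⟩ : ∃ T, IsKTriangulation n k T ∧ stepEdges n k (beamRows k I) ⊆ T ∧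
      ¬ stepEdges n k (beamRows k (L (w' i))) ⊆ T := by
    by_cases hiI : i ∈ I
    · have hjI := hij.1 hiI
      refine exists_not_stepEdges_subset_of_ssubset hk (beamRows_subset_middle I) hI
        ⟨k + i, add_mem_beamRows.2 hi⟩ (beamRows_ssubset_iff.2 ?_)
      refine ⟨(hLI _).resolve_right fun h => hj (h hjI), fun h => hj (h hjI)⟩
    · refine exists_not_stepEdges_subset_of_ssuperset hk (beamRows_ssubset_iff.2 ?_) ?_
      · exact ⟨(hLI _).resolve_left fun h => hiI (h hi), fun h => hiI (h hi)⟩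
      · rw [← beamRows_univ, beamRows_ssubset_iff]
        exact ⟨Finset.subset_univ _, fun h => hj (h (Finset.mem_univ j))⟩
  exact hnot (hall _ T hT hD)

end Polytope

/-! ### Dimensions of faces -/

section Dimension

theorem finrank_inf_ker_add_one {V : Type*} [AddCommGroup V] [Module ℝ V] [FiniteDimensional ℝ V]
    (K : Submodule ℝ V) (f : V →ₗ[ℝ] ℝ) (hf : ∃ v ∈ K, f v ≠ 0) :
    Module.finrank ℝ ↥(K ⊓ LinearMap.ker f) + 1 = Module.finrank ℝ K := by
  obtain ⟨v, hv, hfv⟩ := hf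
  have h1 : f.domRestrict K ≠ 0 := fun h => hfv (by
    simpa using LinearMap.congr_fun h ⟨v, hv⟩)
  rw [← Module.Dual.finrank_ker_add_one_of_ne_zero (f := f.domRestrict K) h1,
    ← Submodule.map_comap_subtype, Submodule.finrank_map_subtype_eq]
  rfl

/-- The vectors whose coordinate sum and whose sum of the coordinates in `I` are zero. -/
def zeroSums {q : ℕ} (I : Finset (Fin q)) : Submodule ℝ (Fin q → ℝ) :=
  LinearMap.ker (∑ i, LinearMap.proj (R := ℝ) (φ := fun _ : Fin q => ℝ) i) ⊓
    LinearMap.ker (∑ i ∈ I, LinearMap.proj (R := ℝ) (φ := fun _ : Fin q => ℝ) i)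

theorem mem_zeroSums {q : ℕ} {I : Finset (Fin q)} {d : Fin q → ℝ} :
    d ∈ zeroSums I ↔ ∑ i, d i = 0 ∧ ∑ i ∈ I, d i = 0 := by
  simp [zeroSums, LinearMap.sum_apply]

theorem finrank_zeroSums_add_one {q : ℕ} {I : Finset (Fin q)} (hI : I.Nonempty)
    (hI' : I ≠ Finset.univ) :
    Module.finrank ℝ ↥(zeroSums I) + 1 = Module.finrank ℝ ↥(zeroSums (∅ : Finset (Fin q))) := by
  have h0 : zeroSums (∅ : Finset (Fin q)) =
      LinearMap.ker (∑ i, LinearMap.proj (R := ℝ) (φ := fun _ : Fin q => ℝ) i) := by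
    simp [zeroSums]
  obtain ⟨i, hi⟩ := hI
  obtain ⟨j, hj⟩ : ∃ j, j ∉ I := by
    by_contra! h
    exact hI' (Finset.eq_univ_iff_forall.2 h)
  have hij : i ≠ j := ne_of_mem_of_not_mem hi hj
  rw [h0, zeroSums]
  refine finrank_inf_ker_add_one _ _ ⟨Pi.single i 1 - Pi.single j 1, ?_, ?_⟩
  · simp [LinearMap.sum_apply, Finset.sum_sub_distrib]
  · simp [LinearMap.sum_apply, Finset.sum_sub_distrib, hi, hj]

variable {n k : ℕ} {I : Finset (Fin (n - 2 * k))}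

theorem vectorSpan_eq_zeroSums (hk : 1 ≤ k) (hI : HasShortGaps k (beamRows k I))
    {P : Set (Fin (n - 2 * k) → ℝ)} (hP : P ⊆ beamPolytope n k)
    (hPI : ∀ x ∈ P, ∀ y ∈ P, ∑ i ∈ I, x i = ∑ i ∈ I, y i)
    (hT : ∀ T, IsKTriangulation n k T → stepEdges n k (beamRows k I) ⊆ T →
      beamVector n k T ∈ P) : vectorSpan ℝ P = zeroSums I := by
  classical
  apply le_antisymm
  · rw [vectorSpan_def, Submodule.span_le]
    rintro _ ⟨x, hx, y, hy, rfl⟩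
    rw [SetLike.mem_coe, mem_zeroSums]
    simp only [vsub_eq_sub, Pi.sub_apply, Finset.sum_sub_distrib, sub_eq_zero]
    exact ⟨sum_eq_of_mem_beamPolytope hk (hP hx) (hP hy), hPI x hx y hy⟩
  · intro d hd
    by_contra hnot
    obtain ⟨f, hfd, hf⟩ := Submodule.exists_le_ker_of_notMem hnot
    refine hfd ?_
    set w : Fin (n - 2 * k) → ℝ := fun i => f (Pi.single i 1) with hw
    have hfw : ∀ x, f x = w ⬝ᵥ x := by
      intro x
      rw [LinearMap.pi_apply_eq_sum_univ f x, dotProduct]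
      refine Finset.sum_congr rfl fun i _ => ?_
      rw [smul_eq_mul, mul_comm, hw]
      congr 2
      ext j
      simp [Pi.single_apply, eq_comm]
    have hconst : ∀ T T', IsKTriangulation n k T → IsKTriangulation n k T' →
        stepEdges n k (beamRows k I) ⊆ T → stepEdges n k (beamRows k I) ⊆ T' →
        w ⬝ᵥ beamVector n k T = w ⬝ᵥ beamVector n k T' := by
      intro T T' h1 h2 h3 h4
      have := hf (vsub_mem_vectorSpan ℝ (hT T h1 h3) (hT T' h2 h4))
      rw [LinearMap.mem_ker, vsub_eq_sub, map_sub, sub_eq_zero] at this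
      rwa [← hfw, ← hfw]
    have heq : ∀ i j, (i ∈ I ↔ j ∈ I) → w i = w j := fun i j hij =>
      le_antisymm (eq_of_constant_on_face hk hI hconst hij)
        (eq_of_constant_on_face hk hI hconst hij.symm)
    have hone : ∀ A : Finset (Fin (n - 2 * k)), (∀ i ∈ A, ∀ j ∈ A, w i = w j) →
        ∑ i ∈ A, d i = 0 → ∑ i ∈ A, w i * d i = 0 := by
      intro A hA hsum
      rcases A.eq_empty_or_nonempty with rfl | ⟨a, ha⟩
      · simp
      · rw [Finset.sum_congr rfl fun i hi => by rw [hA i hi a ha], ← Finset.mul_sum, hsum, mul_zero]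
    obtain ⟨h1, h2⟩ := mem_zeroSums.1 hd
    have h3 : ∑ i ∈ Iᶜ, d i = 0 := by
      rw [← Finset.sum_add_sum_compl I, h2, zero_add] at h1
      exact h1
    rw [hfw, dotProduct, ← Finset.sum_add_sum_compl I,
      hone I (fun i hi j hj => heq i j (by simp [hi, hj])) h2,
      hone Iᶜ (fun i hi j hj => heq i j (by
        rw [Finset.mem_compl] at hi hj
        simp [hi, hj])) h3, add_zero]

theorem affDim_beamPolytope (hk : 1 ≤ k) :
    affDim (beamPolytope n k) =
      Module.finrank ℝ ↥(zeroSums (∅ : Finset (Fin (n - 2 * k)))) := by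
  rw [affDim, direction_affineSpan, vectorSpan_eq_zeroSums (I := ∅) hk
    (by simp [HasShortGaps, beamRows]) subset_rfl (by simp) fun T hT _ => beamVector_mem hT]

theorem isFacet_face (hk : 1 ≤ k) {σ : Fin (n - 2 * k) → Bool} (hσ : IsValidSeq k σ) :
    IsFacet (beamPolytope n k) (faceOfNormal (beamPolytope n k) (seqVector σ)) := by
  obtain ⟨h1, h2, h3⟩ := (isValidSeq_iff σ).1 hσ
  obtain ⟨T, hT, hD⟩ := exists_isKTriangulation_of_isChain (n := n) (k := k)
    (Set.subsingleton_singleton (a := beamRows k (oneIndices σ))).isChain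
  refine ⟨⟨_, (beamVector_mem_face_iff hk hT).2 (hD _ rfl)⟩, ⟨_, rfl⟩, ?_⟩
  rw [affDim_beamPolytope hk, affDim, direction_affineSpan,
    vectorSpan_eq_zeroSums hk h3 (fun x hx => hx.1) ?_ fun T hT hD =>
      (beamVector_mem_face_iff hk hT).2 hD]
  · exact finrank_zeroSums_add_one h1 h2
  · intro x hx y hy
    rw [((mem_face_iff hk hT (hD _ rfl)).1 hx).2, ((mem_face_iff hk hT (hD _ rfl)).1 hy).2]

/-- The linear form `w` is a positive combination of the indicators of its superlevel sets, up to a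
constant, and all of these are minimal at a common beam vector. So a minimizer of `w` also minimizes
the sum over each superlevel set, and over the first block of such a set. -/
theorem exists_valid_face_subset (hk : 1 ≤ k) {w : Fin (n - 2 * k) → ℝ} {i j : Fin (n - 2 * k)}
    (hij : w i < w j) : ∃ σ : Fin (n - 2 * k) → Bool, IsValidSeq k σ ∧
      faceOfNormal (beamPolytope n k) w ⊆ faceOfNormal (beamPolytope n k) (seqVector σ) := by
  set L : ℝ → Finset (Fin (n - 2 * k)) := fun t => Finset.univ.filter fun l => t ≤ w l with hL
  have hLmono : ∀ s t, s ≤ t → L t ⊆ L s := fun s t hst l hl => by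
    simp only [hL, Finset.mem_filter, Finset.mem_univ, true_and] at hl ⊢
    exact hst.trans hl
  obtain ⟨T, hT, hD⟩ := exists_isKTriangulation_of_isChain (n := n) (k := k)
    (𝒮 := Set.range fun t => beamRows k (L t)) (by
      rintro _ ⟨s, rfl⟩ _ ⟨t, rfl⟩ _
      rcases le_total s t with h | h
      · exact Or.inr (beamRows_subset_iff.2 (hLmono s t h))
      · exact Or.inl (beamRows_subset_iff.2 (hLmono t s h)))
  have hDL : ∀ t, stepEdges n k (beamRows k (L t)) ⊆ T := fun t => hD _ ⟨t, rfl⟩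
  have hj : j ∈ L (w j) := by simp [hL]
  have hi : i ∉ L (w j) := by simpa [hL] using hij
  obtain ⟨B, hB, hBne, hgaps, hBT⟩ := exists_hasShortGaps_subset (n := n) hk
    (S := beamRows k (L (w j))) ⟨_, add_mem_beamRows.2 hj⟩
  obtain ⟨hB1, hB2⟩ := hBT T hT (hDL _)
  obtain ⟨I, rfl⟩ := exists_beamRows_eq (hB.trans (beamRows_subset_middle _))
  obtain ⟨I', hI'⟩ := exists_beamRows_eq (n := n) (k := k)
    (Finset.sdiff_subset.trans (beamRows_subset_middle (L (w j))) :
      beamRows k (L (w j)) \ beamRows k I ⊆ _)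
  have hIL : I ⊆ L (w j) := beamRows_subset_iff.1 hB
  have hI'eq : I' = L (w j) \ I := by
    ext l
    rw [← add_mem_beamRows (k := k), hI', Finset.mem_sdiff, add_mem_beamRows, add_mem_beamRows,
      Finset.mem_sdiff]
  rw [← hI'] at hB2
  have hone : oneIndices (fun l => decide (l ∈ I)) = I := by
    ext l
    simp [mem_oneIndices]
  refine ⟨fun l => decide (l ∈ I), (isValidSeq_iff _).2 ?_, fun x hx => ?_⟩
  · rw [hone]
    refine ⟨?_, fun h => ?_, hgaps⟩
    · obtain ⟨b, hb⟩ := hBne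
      obtain ⟨l, hl, -⟩ := mem_beamRows.1 hb
      exact ⟨l, hl⟩
    · exact hi (hIL (h ▸ Finset.mem_univ i))
  · rw [mem_face_iff hk hT (by rwa [hone]), hone]
    refine ⟨hx.1, ?_⟩
    have h1 := sum_level_eq_zero w (fun l => x l - beamVector n k T l) (by
      rw [Finset.sum_sub_distrib, sub_eq_zero]
      exact sum_eq_of_mem_beamPolytope hk hx.1 (beamVector_mem hT)) (fun t => by
      rw [Finset.sum_sub_distrib, sub_nonneg]
      exact sum_beamVector_le_of_mem hk hT (hDL t) hx.1) (by
      have := hx.2 _ (beamVector_mem hT)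
      simp only [mul_sub, Finset.sum_sub_distrib]
      exact sub_nonpos.2 this) (w j)
    change ∑ l ∈ L (w j), (x l - beamVector n k T l) = 0 at h1
    have h2 := sum_beamVector_le_of_mem hk hT hB1 hx.1
    have h3 := sum_beamVector_le_of_mem hk hT hB2 hx.1
    rw [← Finset.sum_sdiff hIL, ← hI'eq, Finset.sum_sub_distrib, Finset.sum_sub_distrib] at h1
    linarith

/-- A face contained in a set of the same dimension is the whole set, because its linear form is
constant on its affine hull. -/
theorem face_eq_of_subset_of_affDim_eq {q : ℕ} {P G : Set (Fin q → ℝ)} {w : Fin q → ℝ}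
    (hG : G ⊆ P) (hne : (faceOfNormal P w).Nonempty) (hsub : faceOfNormal P w ⊆ G)
    (hdim : affDim (faceOfNormal P w) = affDim G) : faceOfNormal P w = G := by
  refine hsub.antisymm fun x hx => ?_
  obtain ⟨y, hy⟩ := hne
  rw [affDim, affDim, direction_affineSpan, direction_affineSpan] at hdim
  have hspan := Submodule.eq_of_le_of_finrank_eq (vectorSpan_mono ℝ hsub) hdim
  have h1 : x - y ∈ vectorSpan ℝ (faceOfNormal P w) := by
    rw [hspan]
    exact vsub_mem_vectorSpan ℝ hx (hsub hy)
  have h2 : ∀ d ∈ vectorSpan ℝ (faceOfNormal P w), w ⬝ᵥ d = 0 := by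
    intro d hd
    rw [vectorSpan_def] at hd
    induction hd using Submodule.span_induction with
    | mem d hd =>
      obtain ⟨a, ha, b, hb, rfl⟩ := hd
      change w ⬝ᵥ (a - b) = 0
      rw [dotProduct_sub, sub_eq_zero]
      exact le_antisymm (ha.2 b hb.1) (hb.2 a ha.1)
    | zero => simp
    | add a b _ _ ha hb => rw [dotProduct_add, ha, hb, add_zero]
    | smul r a _ ha => rw [dotProduct_smul, ha, smul_zero]
  have h3 := h2 _ h1
  rw [dotProduct_sub, sub_eq_zero] at h3
  exact ⟨hG hx, fun z hz => h3 ▸ hy.2 z hz⟩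

end Dimension

theorem mainTheorem2 (n k : ℕ) (hk : 1 ≤ k) (hn : 2 * k + 1 ≤ n) :
    (∀ σ : Fin (n - 2 * k) → Bool, IsValidSeq k σ →
      IsFacet (beamPolytope n k) (faceOfNormal (beamPolytope n k) (seqVector σ)) ∧
      ∀ T : Finset (ℕ × ℕ), IsKTriangulation n k T →
        (beamVector n k T ∈ faceOfNormal (beamPolytope n k) (seqVector σ) ↔ edgeSetD n k σ ⊆ T)) ∧
    (∀ F : Set (Fin (n - 2 * k) → ℝ), IsFacet (beamPolytope n k) F →
      ∃ σ : Fin (n - 2 * k) → Bool, IsValidSeq k σ ∧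
        F = faceOfNormal (beamPolytope n k) (seqVector σ)) := by
  refine ⟨fun σ hσ => ⟨isFacet_face hk hσ, fun T hT => ?_⟩, ?_⟩
  · rw [edgeSetD_eq_stepEdges hk hn]
    exact beamVector_mem_face_iff hk hT
  · rintro _ ⟨hne, ⟨w, rfl⟩, hdim⟩
    have hw : ∃ i j, w i < w j := by
      -- A constant form is minimal on the whole polytope.
      by_contra! hcon
      have hconst : ∀ x ∈ beamPolytope n k, ∀ y ∈ beamPolytope n k, w ⬝ᵥ x ≤ w ⬝ᵥ y := by
        intro x hx y hy
        have h0 : (0 : ℕ) < n - 2 * k := by omega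
        have hz : ∀ z : Fin (n - 2 * k) → ℝ, w ⬝ᵥ z = w ⟨0, h0⟩ * ∑ i, z i := by
          intro z
          rw [dotProduct, Finset.mul_sum]
          refine Finset.sum_congr rfl fun i _ => ?_
          rw [le_antisymm (hcon ⟨0, h0⟩ i) (hcon i ⟨0, h0⟩)]
        rw [hz, hz, sum_eq_of_mem_beamPolytope hk hx hy]
      have : faceOfNormal (beamPolytope n k) w = beamPolytope n k :=
        Set.Subset.antisymm (fun x hx => hx.1) fun x hx => ⟨hx, hconst x hx⟩
      rw [this] at hdim
      omega
    obtain ⟨i, j, hij⟩ := hw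
    obtain ⟨σ, hσ, hsub⟩ := exists_valid_face_subset hk hij
    refine ⟨σ, hσ, face_eq_of_subset_of_affDim_eq (fun x hx => hx.1) hne hsub ?_⟩
    have := (isFacet_face hk hσ).2.2
    omega
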